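/- Let $L$ be an algebraically closed field of arbitrary characteristic, let $K\supseteq L$ be an algebraically closed extension of infinite transcendence degree over $L$, and fix a specialisation $\pi$ of $K$ onto $L$, i.e. an $L$-valued place of $K$ that is the identity on $L$; it induces a map $\pi:\mathbb P^2(K)\to\mathbb P^2(L)$. Let $F,G\in L[X_0,X_1,X_2]$ be nonzero homogeneous polynomials of degrees $d$ and $e$, defining projective plane curves $C_1=\{F=0\}$ and $C_2=\{G=0\}$ (possibly reducible or with non-reduced components), and suppose that $C_1$ and $C_2$ meet in finitely many points $x_1,\dots,x_n\in\mathbb P^2(L)$. A generic deformation of $(F,G)$ is a pair $(F',G')$ of homogeneous polynomials over $K$ of degrees $d$ and $e$ whose coefficients are finite at $\pi$ and specialise to the corresponding coefficients of $F$ and $G$, and such that the coefficients of all monomials of degree $d$ in $F'$ and of all monomials of degree $e$ in $G'$ are, taken together, algebraically independent over $L$. Then generic deformations of $(F,G)$ exist whenever $n\ge 1$, and for each $i$ the number $$M(C_1,C_2,x_i)=\#\{y\in\mathbb P^2(K): F'(y)=G'(y)=0,\ \pi(y)=x_i\}$$ is finite and is the same for all generic deformations $(F',G')$ of $(F,G)$;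 this is the Zariski multiplicity of $C_1$ and $C_2$ at $x_i$. It equals the intersection multiplicity of $C_1$ and $C_2$ at $x_i$, that is, the length of $\mathcal O_{\mathbb P^2,x_i}/(f,g)$, where $f,g$ are local equations of $C_1,C_2$ at $x_i$. Moreover $$\sum_{i=1}^n M(C_1,C_2,x_i)=de .$$ -/

import Mathlib

open scoped LinearAlgebra.Projectivization

/-- A specialisation of `K` onto its subfield `L`: an `L`-valued place of `K` that is the identity
on `L`, given by its valuation ring together with the residue map onto `L`. (The kernel of `res` is
automatically the maximal ideal of the valuation ring, since `res` is onto the field `L`.) -/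
structure Specialisation (L K : Type*) [Field L] [Field K] [Algebra L K] where
  /-- the elements of `K` with a finite specialisation -/
  ring : ValuationSubring K
  algebraMap_mem : ∀ c : L, algebraMap L K c ∈ ring
  /-- the specialisation of a finite element -/
  res : ring →+* L
  res_algebraMap : ∀ c : L, res ⟨algebraMap L K c, algebraMap_mem c⟩ = c

/-- The common zeros in `ℙ²(k)` of two homogeneous forms in three variables. -/
def commonZeros {k : Type*} [Field k] (F G : MvPolynomial (Fin 3) k) : Set (ℙ k (Fin 3 → k)) :=
  {x | MvPolynomial.eval x.rep F = 0 ∧ MvPolynomial.eval x.rep G = 0}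

namespace Specialisation

variable {L K : Type*} [Field L] [Field K] [Algebra L K] (S : Specialisation L K)

/-- The specialisation map `ℙ²(K) → ℙ²(L)`, as a relation: `y` specialises to `x`, that is, `y` lies
in the infinitesimal neighbourhood `𝒱_x`. A point of `ℙ²(K)` has homogeneous coordinates in the
valuation ring that do not all specialise to zero; its image is obtained by specialising these. -/
def PointTo (y : ℙ K (Fin 3 → K)) (x : ℙ L (Fin 3 → L)) : Prop :=
  ∃ (w : Fin 3 → S.ring) (hK : (fun j => (w j : K)) ≠ 0) (hL : (fun j => S.res (w j)) ≠ 0),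
    y = Projectivization.mk K _ hK ∧ x = Projectivization.mk L _ hL

/-- The form `F'` over `K` specialises to the form `F` over `L`, coefficient by coefficient. -/
def FormTo (F' : MvPolynomial (Fin 3) K) (F : MvPolynomial (Fin 3) L) : Prop :=
  ∀ m : Fin 3 →₀ ℕ, ∃ h : F'.coeff m ∈ S.ring, S.res ⟨F'.coeff m, h⟩ = F.coeff m

/-- The pair `(F', G')` of forms over `K` of degrees `d` and `e` is a point, generic over `L`, of
the product of the affine parameter spaces of forms of degrees `d` and `e`, and it lies in the
infinitesimal neighbourhood of the pair `(F, G)` of forms over `L`. Generic means that all the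
coefficients of the two forms are algebraically independent over `L`. -/
structure IsGenericDeformation (d e : ℕ) (F G : MvPolynomial (Fin 3) L)
    (F' G' : MvPolynomial (Fin 3) K) : Prop where
  homogeneous_left : F'.IsHomogeneous d
  homogeneous_right : G'.IsHomogeneous e
  formTo_left : S.FormTo F' F
  formTo_right : S.FormTo G' G
  generic : AlgebraicIndependent L
    (Sum.elim (fun m : {m : Fin 3 →₀ ℕ // m.degree = d} => F'.coeff m.1)
      (fun m : {m : Fin 3 →₀ ℕ // m.degree = e} => G'.coeff m.1))

/-- The Zariski multiplicity at `(x, F, G)` of the cover of the parameter space of pairs of curves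
of degrees `d` and `e` whose fibre over a pair is the intersection of the two curves is equal to
`μ`: generic deformations of `(F, G)` exist, and for every one of them the number of points of the
intersection of the deformed curves in `ℙ²(K)` that specialise to `x` is `μ`. -/
def HasZariskiMultiplicity (d e : ℕ) (F G : MvPolynomial (Fin 3) L) (x : ℙ L (Fin 3 → L))
    (μ : ℕ) : Prop :=
  (∃ F' G' : MvPolynomial (Fin 3) K, S.IsGenericDeformation d e F G F' G') ∧
    ∀ F' G' : MvPolynomial (Fin 3) K, S.IsGenericDeformation d e F G F' G' →
      (commonZeros F' G' ∩ {y | S.PointTo y x}).encard = μ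

end Specialisation

/-- The equation, in the affine chart where the `i`-th homogeneous coordinate is `1`, of the curve
defined by the form `F`. -/
noncomputable def dehomogenise {L : Type*} [Field L] (i : Fin 3) (F : MvPolynomial (Fin 3) L) :
    MvPolynomial (Fin 2) L :=
  MvPolynomial.aeval (i.insertNth (1 : MvPolynomial (Fin 2) L) MvPolynomial.X :
    Fin 3 → MvPolynomial (Fin 2) L) F

/-- The ideal of all polynomials in two variables that vanish at the point `p`. -/
noncomputable def pointIdeal {L : Type*} [Field L] (p : Fin 2 → L) : Ideal (MvPolynomial (Fin 2) L) :=
  RingHom.ker (MvPolynomial.eval p)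

instance {L : Type*} [Field L] (p : Fin 2 → L) : (pointIdeal p).IsPrime :=
  RingHom.ker_isPrime (MvPolynomial.eval p)

/-- The local ring of the affine plane at the point `p`. -/
abbrev PlaneLocalRing {L : Type*} [Field L] (p : Fin 2 → L) : Type _ :=
  Localization.AtPrime (pointIdeal p)

/-- The intersection multiplicity at `p` of the affine plane curves `f = 0` and `g = 0`: the length
of the quotient of the local ring at `p` by the ideal generated by `f` and `g`. -/
noncomputable def affineIntersectionMultiplicity {L : Type*} [Field L]
    (f g : MvPolynomial (Fin 2) L) (p : Fin 2 → L) : ℕ∞ :=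
  Module.length (PlaneLocalRing p)
    (PlaneLocalRing p ⧸ Ideal.span {algebraMap (MvPolynomial (Fin 2) L) (PlaneLocalRing p) f,
      algebraMap (MvPolynomial (Fin 2) L) (PlaneLocalRing p) g})

/-- The intersection multiplicity at `x` of the projective plane curves `F = 0` and `G = 0` is `μ`,
computed in any of the standard affine charts that contain `x`. -/
def HasIntersectionMultiplicity {L : Type*} [Field L] (F G : MvPolynomial (Fin 3) L)
    (x : ℙ L (Fin 3 → L)) (μ : ℕ) : Prop :=
  ∀ i : Fin 3, x.rep i ≠ 0 →
    affineIntersectionMultiplicity (dehomogenise i F) (dehomogenise i G)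
      (fun j => x.rep (i.succAbove j) / x.rep i) = μ

/-!
Write `I_x` for the dimension over `L` of the local ring `𝒪_x / (f, g)` of the intersection at a
point `x`, which is also its length because the residue field is `L`. Fix a generic deformation
`(F', G')`. The theorem follows by playing three inequalities against each other.

* `Σ_x I_x ≤ d e` (`sum_finrank_localRing_le`). Finiteness of the intersection makes `F` and `G`
  coprime (`isRelPrime_of_finite_commonZeros`), so the syzygies of `(F, G)` are the trivial ones and
  a dimension count bounds the codimension of `(F, G)` in each large degree by `d e`. Forms of large
  degree realise every choice of truncated Taylor expansions at the points `x`, so the truncated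
  local rings have total dimension at most `d e`. Hence they stabilise as the order of truncation
  grows, and Nakayama's lemma identifies the stable value with `𝒪_x / (f, g)`.

* At most `I_x` common zeros of `F'` and `G'` specialise to `x`
  (`Specialisation.encard_inter_le_finrank`). In an affine chart, restrict polynomials over the
  valuation ring `R` to `r` such zeros. The image `E` in `R ^ r` is a finite `R`-module, as `R ^ r` is
  integral over `R`. Modulo the maximal ideal it is spanned by the lifts of `I_x` polynomials
  representing a basis of `𝒪_x / (f, g)`, so by Nakayama's lemma these lifts span it over `R`. As the
  points are distinct, `E` spans `K ^ r`, and `r ≤ I_x`.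

* `F'` and `G'` have at least `d e` common zeros
  (`exists_finset_card_eq_mul_of_algebraicIndependent`). The generic coefficients specialise, along
  some place of `K`, to those of two products of lines that meet in `d e` points with distinct
  projections to a line. The projections are roots of a resultant, roots of polynomials lift along
  places of an algebraically closed field, and roots of the resultant of `F'` and `G'` come from
  common zeros.

Every common zero of `F'` and `G'` specialises to a common zero of `F` and `G`, so all inequalities
are equalities, for every generic deformation and in every chart. This uses no coordinate change,
no assumption on the characteristic, and no transversality argument beyond the special pair of
products of lines. Generic deformations exist because the valuation ring contains a transcendence
basis of `K` over `L`, whose elements can be translated by constants.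
-/

open MvPolynomial

/-! ### Forms in three variables: dimension count and coprimality -/

theorem homogeneousComponent_mul_of_isHomogeneous {σ k : Type*} [CommSemiring k] {d : ℕ}
    {F : MvPolynomial σ k} (hF : F.IsHomogeneous d) (C : MvPolynomial σ k) (c : ℕ) :
    homogeneousComponent (d + c) (F * C) = F * homogeneousComponent c C := by
  conv_lhs => rw [← sum_homogeneousComponent C, Finset.mul_sum, map_sum]
  simp_rw [fun i => homogeneousComponent_of_mem (m := d + c)
    (hF.mul (homogeneousComponent_isHomogeneous i C)), add_right_inj]
  rw [Finset.sum_ite_eq]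
  split_ifs with h
  · rfl
  · rw [homogeneousComponent_eq_zero, mul_zero]
    simpa using h

theorem finrank_homogeneousSubmodule_fin_three (k : Type*) [Field k] (n : ℕ) :
    Module.finrank k (homogeneousSubmodule (Fin 3) k n) = (n + 2).choose 2 := by
  classical
  have e : homogeneousSubmodule (Fin 3) k n ≃ₗ[k] ({d : Fin 3 →₀ ℕ | d.degree = n} →₀ k) :=
    (LinearEquiv.ofEq _ _ (homogeneousSubmodule_eq_finsupp_supported (Fin 3) k n)).trans
      (AddMonoidAlgebra.supportedEquivFinsupp _)
  have hs : {d : Fin 3 →₀ ℕ | d.degree = n} = ((Finset.univ : Finset (Fin 3)).finsuppAntidiag n) := by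
    ext d
    simp [Finset.mem_finsuppAntidiag, Finsupp.degree_eq_sum]
  rw [e.finrank_eq, hs]
  rw [Module.finrank_finsupp_self]
  simp only [Finset.coe_sort_coe, Fintype.card_coe]
  rw [Finset.card_finsuppAntidiag_nat_eq_choose]
  simp only [Finset.card_univ, Fintype.card_fin]
  rw [show 3 + n - 1 = n + 2 by omega, Nat.choose_symm_add]

instance {k : Type*} [Field k] (n : ℕ) : Module.Finite k (homogeneousSubmodule (Fin 3) k n) :=
  Module.Finite.iff_fg.mpr (homogeneousSubmodule_fg _ _ n)

/-- For coprime forms `F` and `G` of degrees `d` and `e`, the codimension of the ideal `(F, G)` in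
degree `d + e + c` is at most `d e`. Coprimality enters as exactness of the Koszul complex
`P_c → P_{e+c} × P_{d+c} → P_{d+e+c}` in the middle, `P_n` being the space of forms of degree `n`. -/
theorem card_le_mul_of_linearIndependent_modulo {k : Type*} [Field k] {d e : ℕ}
    {F G : MvPolynomial (Fin 3) k} (hF : F.IsHomogeneous d) (hG : G.IsHomogeneous e)
    (hF0 : F ≠ 0) (hrel : IsRelPrime F G) (c : ℕ) {ι : Type*} [Fintype ι]
    (P : ι → MvPolynomial (Fin 3) k) (hP : ∀ i, (P i).IsHomogeneous (d + e + c))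
    (hind : ∀ a : ι → k, ∑ i, a i • P i ∈ Ideal.span {F, G} → a = 0) :
    Fintype.card ι ≤ d * e := by
  let H := homogeneousSubmodule (Fin 3) k
  let Φ : H (e + c) × H (d + c) →ₗ[k] MvPolynomial (Fin 3) k :=
    LinearMap.coprod ((LinearMap.mulRight k F).comp (H (e + c)).subtype)
      ((LinearMap.mulRight k G).comp (H (d + c)).subtype)
  have hΦ : ∀ A B, Φ (A, B) = A.1 * F + B.1 * G := fun A B => by simp [Φ]
  let Ψ : H c →ₗ[k] H (e + c) × H (d + c) :=
    LinearMap.prod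
      (((LinearMap.mulRight k G).comp (H c).subtype).codRestrict _ fun C => by
        rw [add_comm]; exact (C.2 : IsHomogeneous _ _).mul hG)
      ((-(LinearMap.mulRight k F).comp (H c).subtype).codRestrict _ fun C => by
        rw [add_comm]; exact ((C.2 : IsHomogeneous _ _).mul hF).neg)
  have hΨ₁ : ∀ C, ((Ψ C).1 : MvPolynomial (Fin 3) k) = C.1 * G := fun C => rfl
  have hΨ₂ : ∀ C, ((Ψ C).2 : MvPolynomial (Fin 3) k) = -(C.1 * F) := fun C => rfl
  have hker : LinearMap.ker Φ ≤ LinearMap.range Ψ := by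
    rintro ⟨A, B⟩ hAB
    rw [LinearMap.mem_ker, hΦ] at hAB
    have hdvd : F ∣ B.1 := by
      refine hrel.dvd_of_dvd_mul_right ⟨-A.1, ?_⟩
      linear_combination hAB
    obtain ⟨C, hC⟩ := hdvd
    have hB : B.1 = F * homogeneousComponent c C := by
      rw [← homogeneousComponent_mul_of_isHomogeneous hF, ← hC,
        homogeneousComponent_eq_self B.2]
    refine ⟨⟨-homogeneousComponent c C, (homogeneousComponent_isHomogeneous c C).neg⟩, ?_⟩
    ext1
    · apply Subtype.ext
      apply mul_right_cancel₀ hF0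
      rw [hΨ₁]
      rw [hB] at hAB
      linear_combination -hAB
    · apply Subtype.ext
      rw [hΨ₂, hB]
      ring
  have hkerdim : Module.finrank k (LinearMap.ker Φ) ≤ (c + 2).choose 2 := by
    rw [← finrank_homogeneousSubmodule_fin_three k c]
    exact (Submodule.finrank_mono hker).trans (LinearMap.finrank_range_le Ψ)
  have hrk := LinearMap.finrank_range_add_finrank_ker Φ
  rw [Module.finrank_prod, finrank_homogeneousSubmodule_fin_three,
    finrank_homogeneousSubmodule_fin_three] at hrk
  have hrange : LinearMap.range Φ ≤ H (d + e + c) := by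
    rintro _ ⟨⟨A, B⟩, rfl⟩
    rw [hΦ]
    refine IsHomogeneous.add ?_ ?_
    · rw [show d + e + c = e + c + d by ring]; exact (A.2 : IsHomogeneous _ _).mul hF
    · rw [show d + e + c = d + c + e by ring]; exact (B.2 : IsHomogeneous _ _).mul hG
  have hrangeI : ∀ p ∈ LinearMap.range Φ, p ∈ Ideal.span {F, G} := by
    rintro _ ⟨⟨A, B⟩, rfl⟩
    rw [hΦ, Ideal.mem_span_pair]
    exact ⟨_, _, rfl⟩
  have hPind : LinearIndependent k P := by
    rw [Fintype.linearIndependent_iff]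
    intro a ha
    exact congrFun (hind a (by rw [ha]; exact zero_mem _))
  have hspan : Submodule.span k (Set.range P) ≤ H (d + e + c) := by
    rw [Submodule.span_le]; rintro _ ⟨i, rfl⟩; exact hP i
  have hdisj : Submodule.span k (Set.range P) ⊓ LinearMap.range Φ = ⊥ := by
    rw [eq_bot_iff]
    rintro p ⟨hp1, hp2⟩
    obtain ⟨a, rfl⟩ := (Submodule.mem_span_range_iff_exists_fun k).1 hp1
    rw [hind a (hrangeI _ hp2)]
    simp
  have := Submodule.finiteDimensional_of_le hrange
  have := Submodule.finiteDimensional_of_le hspan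
  have hsum := Submodule.finrank_sup_add_finrank_inf_eq (Submodule.span k (Set.range P))
    (LinearMap.range Φ)
  have hle := Submodule.finrank_mono (sup_le hspan hrange)
  rw [hdisj, finrank_bot, finrank_span_eq_card hPind] at hsum
  rw [finrank_homogeneousSubmodule_fin_three] at hle
  -- doubling the binomial coefficients turns the count into a polynomial identity
  have h2 : ∀ n : ℕ, 2 * (n + 2).choose 2 = (n + 2) * (n + 1) := fun n => by
    rw [Nat.choose_two_right, Nat.mul_div_cancel' (Nat.even_mul_pred_self _).two_dvd]
    rfl
  have e1 := h2 c
  have e2 := h2 (e + c)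
  have e3 := h2 (d + c)
  have e4 := h2 (d + e + c)
  nlinarith

theorem eval_smul_of_isHomogeneous {σ k : Type*} [CommRing k] {n : ℕ} {F : MvPolynomial σ k}
    (hF : F.IsHomogeneous n) (c : k) (v : σ → k) :
    MvPolynomial.eval (c • v) F = c ^ n * MvPolynomial.eval v F := by
  rw [MvPolynomial.eval_eq, MvPolynomial.eval_eq, Finset.mul_sum]
  refine Finset.sum_congr rfl fun m hm => ?_
  rw [hF.degree_eq_sum_deg_support hm]
  simp only [Pi.smul_apply, smul_eq_mul, mul_pow, Finset.prod_mul_distrib, Finset.prod_pow_eq_pow_sum]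
  ring

/-- Membership in the common zero set can be tested on any homogeneous coordinates, not only on the
chosen representative. -/
theorem mk_mem_commonZeros_iff {k : Type*} [Field k] {d e : ℕ} {F G : MvPolynomial (Fin 3) k}
    (hF : F.IsHomogeneous d) (hG : G.IsHomogeneous e) {v : Fin 3 → k} (hv : v ≠ 0) :
    Projectivization.mk k v hv ∈ commonZeros F G ↔
      MvPolynomial.eval v F = 0 ∧ MvPolynomial.eval v G = 0 := by
  obtain ⟨a, ha⟩ := Projectivization.exists_smul_eq_mk_rep k v hv
  simp only [commonZeros, Set.mem_ofPred_eq, ← ha]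
  rw [Units.smul_def, eval_smul_of_isHomogeneous hF, eval_smul_of_isHomogeneous hG]
  simp

/-- The restriction of a polynomial to a parametrised line `t ↦ w + t v`. -/
noncomputable def restrictToLine {σ k : Type*} [CommRing k] (w v : σ → k) :
    MvPolynomial σ k →ₐ[k] Polynomial k :=
  aeval fun i => Polynomial.C (w i) + Polynomial.C (v i) * Polynomial.X

theorem eval_restrictToLine {σ k : Type*} [CommRing k] (w v : σ → k) (P : MvPolynomial σ k)
    (t : k) : (restrictToLine w v P).eval t = MvPolynomial.eval (w + t • v) P := by
  induction P using MvPolynomial.induction_on with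
  | C a => simp [restrictToLine, Polynomial.algebraMap_eq]
  | add p q hp hq => simp [hp, hq]
  | mul_X p i hp =>
    rw [map_mul, Polynomial.eval_mul, hp, map_mul]
    simp [restrictToLine, mul_comm t]

theorem natDegree_restrictToLine_le {σ k : Type*} [CommRing k] (w v : σ → k)
    (P : MvPolynomial σ k) : (restrictToLine w v P).natDegree ≤ P.totalDegree := by
  have := MvPolynomial.aeval_natDegree_le P le_rfl
    (fun i => Polynomial.C (w i) + Polynomial.C (v i) * Polynomial.X) (n := 1)
    (fun i => by rw [add_comm]; exact Polynomial.natDegree_linear_le)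
  simpa [restrictToLine] using this

theorem coeff_prod_sum_of_natDegree_le {ι k : Type*} [CommRing k] (s : Finset ι)
    (f : ι → Polynomial k) (n : ι → ℕ) (h : ∀ i ∈ s, (f i).natDegree ≤ n i) :
    (∏ i ∈ s, f i).coeff (∑ i ∈ s, n i) = ∏ i ∈ s, (f i).coeff (n i) := by
  classical
  induction s using Finset.induction_on with
  | empty => simp
  | insert a s ha ih =>
    rw [Finset.prod_insert ha, Finset.prod_insert ha, Finset.sum_insert ha,
      Polynomial.coeff_mul_add_eq_of_natDegree_le (h a (Finset.mem_insert_self a s)),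
      ih fun i hi => h i (Finset.mem_insert_of_mem hi)]
    exact (Polynomial.natDegree_prod_le s f).trans
      (Finset.sum_le_sum fun i hi => h i (Finset.mem_insert_of_mem hi))

theorem coeff_restrictToLine_of_isHomogeneous {σ k : Type*} [CommRing k] (w v : σ → k) {n : ℕ}
    {P : MvPolynomial σ k} (hP : P.IsHomogeneous n) :
    (restrictToLine w v P).coeff n = MvPolynomial.eval v P := by
  have hlin : ∀ i, (Polynomial.C (w i) + Polynomial.C (v i) * Polynomial.X).natDegree ≤ 1 :=
    fun i => by rw [add_comm]; exact Polynomial.natDegree_linear_le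
  rw [restrictToLine, MvPolynomial.aeval_def, MvPolynomial.eval₂_eq, MvPolynomial.eval_eq,
    Polynomial.finsetSum_coeff]
  refine Finset.sum_congr rfl fun m hm => ?_
  rw [Polynomial.algebraMap_eq, Polynomial.coeff_C_mul, hP.degree_eq_sum_deg_support hm,
    coeff_prod_sum_of_natDegree_le]
  · congr 1
    refine Finset.prod_congr rfl fun i _ => ?_
    have := Polynomial.coeff_pow_of_natDegree_le (m := m i) (hlin i)
    rw [mul_one] at this
    rw [this]
    simp
  · intro i _
    simpa using Polynomial.natDegree_pow_le_of_le (m i) (hlin i)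

/-- A nonconstant divisor `D` of a form `F` has a zero on every line in a direction `v` with
`F(v) ≠ 0`: the restriction of `F` to the line keeps its degree, hence so does that of `D`. -/
theorem exists_eval_eq_zero_of_dvd_of_isHomogeneous {σ k : Type*} [Field k] [IsAlgClosed k] {d : ℕ}
    {F D : MvPolynomial σ k} (hF : F.IsHomogeneous d) (hD : D ∣ F) (hDu : ¬ IsUnit D)
    {v : σ → k} (hv : MvPolynomial.eval v F ≠ 0) (w : σ → k) :
    ∃ t : k, MvPolynomial.eval (w + t • v) D = 0 := by
  obtain ⟨E, rfl⟩ := hD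
  have hne : D * E ≠ 0 := by rintro h; simp [h] at hv
  have hD0 : D ≠ 0 := left_ne_zero_of_mul hne
  have hcoeff := coeff_restrictToLine_of_isHomogeneous w v hF
  have hline0 : restrictToLine w v (D * E) ≠ 0 := fun h => hv (by rw [← hcoeff, h]; simp)
  have hdeg : d ≤ (restrictToLine w v (D * E)).natDegree :=
    Polynomial.le_natDegree_of_ne_zero (by rwa [hcoeff])
  rw [map_mul] at hdeg hline0
  rw [Polynomial.natDegree_mul (left_ne_zero_of_mul hline0) (right_ne_zero_of_mul hline0)] at hdeg
  have htot := MvPolynomial.totalDegree_mul_of_isDomain hD0 (right_ne_zero_of_mul hne)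
  rw [hF.totalDegree hne] at htot
  have h1 := natDegree_restrictToLine_le w v D
  have h2 := natDegree_restrictToLine_le w v E
  have hDpos : D.totalDegree ≠ 0 := fun h => hDu <| by
    rw [MvPolynomial.totalDegree_eq_zero_iff_eq_C] at h
    rw [h] at hD0 ⊢
    exact (isUnit_iff_ne_zero.2 fun h0 => hD0 (by simp [h0])).map MvPolynomial.C
  obtain ⟨t, ht⟩ := IsAlgClosed.exists_root (restrictToLine w v D) (fun h => by
    have : (restrictToLine w v D).natDegree = 0 := Polynomial.natDegree_eq_of_degree_eq_some h
    omega)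
  exact ⟨t, by rw [← eval_restrictToLine]; exact ht⟩

/-- Two forms with finitely many common zeros are coprime: a nonconstant common factor would vanish
somewhere on each of the infinitely many lines through a point not on `F = 0`. -/
theorem isRelPrime_of_finite_commonZeros {k : Type*} [Field k] [IsAlgClosed k] {d e : ℕ}
    {F G : MvPolynomial (Fin 3) k} (hF : F.IsHomogeneous d) (hG : G.IsHomogeneous e) (hF0 : F ≠ 0)
    (hfin : (commonZeros F G).Finite) : IsRelPrime F G := by
  intro D hDF hDG
  by_contra hDu
  obtain ⟨v, hv⟩ : ∃ v, MvPolynomial.eval v F ≠ 0 := by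
    by_contra! h
    exact hF0 (MvPolynomial.funext fun v => by simpa using h v)
  have hd : d ≠ 0 := by
    rintro rfl
    refine hDu (isUnit_of_dvd_unit hDF ?_)
    rw [← MvPolynomial.totalDegree_zero_iff_isHomogeneous,
      MvPolynomial.totalDegree_eq_zero_iff_eq_C] at hF
    rw [hF] at hF0 ⊢
    exact (isUnit_iff_ne_zero.2 fun h0 => hF0 (by simp [h0])).map MvPolynomial.C
  have hv0 : v ≠ 0 := by
    rintro rfl
    apply hv
    have := eval_smul_of_isHomogeneous hF (0 : k) 0
    simpa [hd] using this
  obtain ⟨i, hi⟩ := Function.ne_iff.1 hv0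
  -- the lines through `v`, parametrised by the two coordinates other than the `i`-th
  let w : k → Fin 3 → k := fun c => i.insertNth 0 ![1, c]
  choose t ht using fun c => exists_eval_eq_zero_of_dvd_of_isHomogeneous hF hDF hDu hv (w c)
  have hcoord : ∀ (c : k) (j : Fin 2),
      v i * (w c + t c • v) (i.succAbove j) - (w c + t c • v) i * v (i.succAbove j)
        = v i * ![1, c] j := by
    intro c j
    simp [w]; ring
  have hne : ∀ c, w c + t c • v ≠ 0 := by
    intro c h
    have := hcoord c 0
    rw [h] at this
    simp at this
    exact hi this.symm
  have hinj : Function.Injective fun c => Projectivization.mk k _ (hne c) := by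
    intro c c' hcc
    obtain ⟨a, ha⟩ := (Projectivization.mk_eq_mk_iff' _ _ _ _ _).1 hcc
    have key : ∀ j, v i * ![1, c] j = a * (v i * ![1, c'] j) := by
      intro j
      rw [← hcoord, ← hcoord, ← ha]
      simp only [Pi.smul_apply, smul_eq_mul]
      ring
    have h0 := key 0
    have h1 := key 1
    simp at h0 h1
    have hi' : v i ≠ 0 := hi
    have ha1 : a = 1 := by
      have : v i * (a - 1) = 0 := by linear_combination -h0
      rcases mul_eq_zero.1 this with h | h
      · exact absurd h hi'
      · linear_combination h
    subst ha1
    simpa [hi'] using h1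
  refine Set.infinite_of_injective_forall_mem hinj (fun c => ?_) hfin
  rw [mk_mem_commonZeros_iff hF hG]
  obtain ⟨A, rfl⟩ := hDF
  obtain ⟨B, rfl⟩ := hDG
  simp [ht c]

/-! ### Local rings of the intersection of two plane curves -/

/-- Dehomogenisation in the `i`-th chart, as a homomorphism of algebras. -/
noncomputable def dehomogeniseHom {k : Type*} [CommRing k] (i : Fin 3) :
    MvPolynomial (Fin 3) k →ₐ[k] MvPolynomial (Fin 2) k :=
  aeval (i.insertNth (1 : MvPolynomial (Fin 2) k) X : Fin 3 → MvPolynomial (Fin 2) k)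

theorem dehomogeniseHom_apply {k : Type*} [Field k] (i : Fin 3) (F : MvPolynomial (Fin 3) k) :
    dehomogeniseHom i F = dehomogenise i F := rfl

theorem eval_dehomogeniseHom {k : Type*} [CommRing k] (i : Fin 3) (F : MvPolynomial (Fin 3) k)
    (p : Fin 2 → k) : eval p (dehomogeniseHom i F) = eval (i.insertNth 1 p : Fin 3 → k) F := by
  induction F using MvPolynomial.induction_on with
  | C a => simp [dehomogeniseHom]
  | add p q hp hq => simp [hp, hq]
  | mul_X P j hP =>
    rw [map_mul, map_mul, hP, map_mul]
    congr 1
    refine Fin.succAboveCases i ?_ (fun j => ?_) j <;> simp [dehomogeniseHom]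

theorem map_dehomogeniseHom {A B : Type*} [CommRing A] [CommRing B] (φ : A →+* B) (i : Fin 3)
    (F : MvPolynomial (Fin 3) A) :
    (dehomogeniseHom i F).map φ = dehomogeniseHom i (F.map φ) := by
  induction F using MvPolynomial.induction_on with
  | C a => simp [dehomogeniseHom]
  | add p q hp hq => simp [hp, hq]
  | mul_X P j hP =>
    rw [map_mul, map_mul, hP, map_mul, map_mul]
    congr 1
    refine Fin.succAboveCases i ?_ (fun j => ?_) j <;> simp [dehomogeniseHom]

/-- Every polynomial in two variables is the dehomogenisation of a form of each large degree. -/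
theorem exists_isHomogeneous_dehomogenise_eq {k : Type*} [Field k] (i : Fin 3)
    (h : MvPolynomial (Fin 2) k) :
    ∃ n₀, ∀ n ≥ n₀, ∃ P : MvPolynomial (Fin 3) k, P.IsHomogeneous n ∧ dehomogenise i P = h := by
  simp only [← dehomogeniseHom_apply]
  induction h using MvPolynomial.induction_on with
  | C a =>
    refine ⟨0, fun n _ => ⟨C a * X i ^ n, by simpa using isHomogeneous_C_mul_X_pow a i n, ?_⟩⟩
    simp [dehomogeniseHom]
  | add p q hp hq =>
    obtain ⟨a, ha⟩ := hp
    obtain ⟨b, hb⟩ := hq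
    refine ⟨max a b, fun n hn => ?_⟩
    obtain ⟨P, hP, rfl⟩ := ha n (le_of_max_le_left hn)
    obtain ⟨Q, hQ, rfl⟩ := hb n (le_of_max_le_right hn)
    exact ⟨P + Q, hP.add hQ, map_add _ _ _⟩
  | mul_X p j hp =>
    obtain ⟨a, ha⟩ := hp
    refine ⟨a + 1, fun n hn => ?_⟩
    obtain ⟨n, rfl⟩ := Nat.exists_eq_add_of_le' (Nat.le_of_add_left_le hn)
    obtain ⟨P, hP, rfl⟩ := ha n (by omega)
    refine ⟨P * X (i.succAbove j), hP.mul (isHomogeneous_X k _), ?_⟩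
    simp [dehomogeniseHom]

instance {k : Type*} [Field k] (p : Fin 2 → k) : (pointIdeal p).IsMaximal :=
  RingHom.ker_isMaximal_of_surjective _ fun a => ⟨C a, by simp⟩

theorem mem_pointIdeal {k : Type*} [Field k] {p : Fin 2 → k} {h : MvPolynomial (Fin 2) k} :
    h ∈ pointIdeal p ↔ eval p h = 0 := Iff.rfl

/-- A polynomial that does not vanish at a point is invertible to any finite order there. -/
theorem exists_mul_sub_one_mem_pointIdeal_pow {k : Type*} [Field k] {p : Fin 2 → k}
    {s : MvPolynomial (Fin 2) k} (hs : eval p s ≠ 0) (r : ℕ) :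
    ∃ u, u * s - 1 ∈ pointIdeal p ^ r := by
  have hcop : IsCoprime (Ideal.span {s}) (pointIdeal p ^ r) := by
    refine IsCoprime.pow_right ?_
    rw [Ideal.isCoprime_iff_sup_eq, sup_comm]
    refine (Ideal.IsMaximal.out : IsCoatom (pointIdeal p)).2 _ (left_lt_sup.2 ?_)
    rwa [Ideal.span_singleton_le_iff_mem]
  obtain ⟨a, ha, b, hb, hab⟩ := Ideal.isCoprime_iff_exists.1 hcop
  obtain ⟨u, rfl⟩ := Ideal.mem_span_singleton'.1 ha
  refine ⟨u, ?_⟩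
  rw [← hab, sub_add_cancel_left]
  exact neg_mem hb

/-- Prescribing the Taylor expansions of a form at finitely many points of the projective plane:
forms of large degree realise all possibilities. -/
theorem exists_isHomogeneous_dehomogenise_sub_mem {k : Type*} [Field k] {ι : Type*} [Fintype ι]
    (i : ι → Fin 3) (p : ι → Fin 2 → k)
    (hsep : ∀ a b, a ≠ b → ∃ l : MvPolynomial (Fin 3) k, l.IsHomogeneous 1 ∧
      eval (p b) (dehomogenise (i b) l) = 0 ∧ eval (p a) (dehomogenise (i a) l) ≠ 0)
    (r : ℕ) (h : ι → MvPolynomial (Fin 2) k) :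
    ∃ n₀, ∀ n ≥ n₀, ∃ P : MvPolynomial (Fin 3) k, P.IsHomogeneous n ∧
      ∀ a, dehomogenise (i a) P - h a ∈ pointIdeal (p a) ^ r := by
  classical
  have single : ∀ a, ∃ n₀, ∀ n ≥ n₀, ∃ P : MvPolynomial (Fin 3) k, P.IsHomogeneous n ∧
      dehomogenise (i a) P - h a ∈ pointIdeal (p a) ^ r ∧
      ∀ b, b ≠ a → dehomogenise (i b) P ∈ pointIdeal (p b) ^ r := by
    intro a
    choose! l hl hlb hla using hsep a
    let E : MvPolynomial (Fin 3) k := ∏ b ∈ Finset.univ.erase a, l b ^ r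
    have hE : E.IsHomogeneous (∑ b ∈ Finset.univ.erase a, 1 * r) :=
      IsHomogeneous.prod _ _ _ fun b hb => (hl b (Finset.ne_of_mem_erase hb).symm).pow r
    have hEa : eval (p a) (dehomogenise (i a) E) ≠ 0 := by
      rw [← dehomogeniseHom_apply, map_prod, map_prod, Finset.prod_ne_zero_iff]
      intro b hb
      rw [map_pow, map_pow]
      exact pow_ne_zero _ (hla b (Finset.ne_of_mem_erase hb).symm)
    obtain ⟨u, hu⟩ := exists_mul_sub_one_mem_pointIdeal_pow hEa r
    obtain ⟨n₀, hn₀⟩ := exists_isHomogeneous_dehomogenise_eq (i a) (u * h a)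
    refine ⟨(∑ b ∈ Finset.univ.erase a, 1 * r) + n₀, fun n hn => ?_⟩
    obtain ⟨n, rfl⟩ := Nat.exists_eq_add_of_le (Nat.le_of_add_right_le hn)
    obtain ⟨T, hT, hTh⟩ := hn₀ n (by omega)
    refine ⟨E * T, hE.mul hT, ?_, fun b hb => ?_⟩
    · rw [← dehomogeniseHom_apply, map_mul, dehomogeniseHom_apply, dehomogeniseHom_apply, hTh]
      have := Ideal.mul_mem_left _ (h a) hu
      convert this using 1
      ring
    · rw [← dehomogeniseHom_apply, map_mul, map_prod]
      refine Ideal.mul_mem_right _ _ (Ideal.mem_of_dvd _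
        (Finset.dvd_prod_of_mem _ (Finset.mem_erase.2 ⟨hb, Finset.mem_univ b⟩)) ?_)
      rw [map_pow]
      exact Ideal.pow_mem_pow (hlb b hb.symm) r
  choose n₀ hn₀ using single
  refine ⟨∑ a, n₀ a, fun n hn => ?_⟩
  choose P hP hPa hPb using fun a => hn₀ a n
    ((Finset.single_le_sum (fun _ _ => Nat.zero_le _) (Finset.mem_univ a)).trans hn)
  refine ⟨∑ a, P a, IsHomogeneous.sum _ _ _ fun a _ => hP a, fun a => ?_⟩
  rw [← dehomogeniseHom_apply, map_sum, ← Finset.add_sum_erase _ _ (Finset.mem_univ a),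
    add_sub_right_comm]
  exact add_mem (hPa a) (sum_mem fun b hb => hPb b a (Finset.ne_of_mem_erase hb).symm)

/-- The polynomials that agree with an element of `(f, g)` up to terms of order at least `r` at `p`.
The quotient by this ideal is the local ring of the intersection at `p`, truncated at order `r`. -/
noncomputable def truncatedIdeal {k : Type*} [Field k] (f g : MvPolynomial (Fin 2) k)
    (p : Fin 2 → k) (r : ℕ) : Ideal (MvPolynomial (Fin 2) k) :=
  Ideal.span {f, g} ⊔ pointIdeal p ^ r

/-- The inequality `≤ d e` in Bézout's theorem, for truncated local rings: lifts of linearly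
independent elements of the product stay independent modulo `(F, G)`. -/
theorem rank_pi_quotient_truncatedIdeal_le {k : Type*} [Field k] {d e : ℕ}
    {F G : MvPolynomial (Fin 3) k} (hF : F.IsHomogeneous d) (hG : G.IsHomogeneous e)
    (hF0 : F ≠ 0) (hrel : IsRelPrime F G) {ι : Type*} [Fintype ι]
    (i : ι → Fin 3) (p : ι → Fin 2 → k)
    (hsep : ∀ a b, a ≠ b → ∃ l : MvPolynomial (Fin 3) k, l.IsHomogeneous 1 ∧
      eval (p b) (dehomogenise (i b) l) = 0 ∧ eval (p a) (dehomogenise (i a) l) ≠ 0) (r : ℕ) :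
    Module.rank k (∀ a, MvPolynomial (Fin 2) k ⧸
      truncatedIdeal (dehomogenise (i a) F) (dehomogenise (i a) G) (p a) r) ≤ (d * e : ℕ) := by
  refine rank_le fun s hs => ?_
  choose h hh using fun (w : s) a => Ideal.Quotient.mk_surjective (w.1 a)
  choose n₀ hn₀ using fun w => exists_isHomogeneous_dehomogenise_sub_mem i p hsep r (h w)
  choose P hP hPa using fun w => hn₀ w (d + e + ∑ w, n₀ w)
    (le_add_left (Finset.single_le_sum (fun _ _ => Nat.zero_le _) (Finset.mem_univ w)))
  have := card_le_mul_of_linearIndependent_modulo hF hG hF0 hrel (∑ w, n₀ w) P hP fun c hc => by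
    have hzero : ∑ w, c w • w.1 = 0 := by
      funext a
      rw [Finset.sum_apply, Pi.zero_apply]
      have h1 : ∀ w : s, (c w • w.1) a = Ideal.Quotient.mkₐ k _ (c w • dehomogeniseHom (i a) (P w)) := by
        intro w
        rw [map_smul, Pi.smul_apply, ← hh w a]
        congr 1
        rw [eq_comm, Ideal.Quotient.mkₐ_eq_mk, Ideal.Quotient.mk_eq_mk_iff_sub_mem]
        exact Ideal.mem_sup_right (hPa w a)
      simp_rw [h1]
      rw [← map_sum]
      simp_rw [← map_smul]
      rw [← map_sum, Ideal.Quotient.mkₐ_eq_mk, Ideal.Quotient.eq_zero_iff_mem]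
      refine Ideal.mem_sup_left ?_
      obtain ⟨A, B, hAB⟩ := Ideal.mem_span_pair.1 hc
      rw [← hAB, map_add, map_mul, map_mul]
      exact Ideal.mem_span_pair.2 ⟨_, _, rfl⟩
    exact funext (Fintype.linearIndependent_iff.1 hs c hzero)
  simpa using this

/-- The truncated local rings stabilise at some order, since their total dimension is bounded. -/
theorem exists_pow_le_truncatedIdeal_succ {k : Type*} [Field k] {d e : ℕ}
    {F G : MvPolynomial (Fin 3) k} (hF : F.IsHomogeneous d) (hG : G.IsHomogeneous e)
    (hF0 : F ≠ 0) (hrel : IsRelPrime F G) {ι : Type*} [Fintype ι]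
    (i : ι → Fin 3) (p : ι → Fin 2 → k)
    (hsep : ∀ a b, a ≠ b → ∃ l : MvPolynomial (Fin 3) k, l.IsHomogeneous 1 ∧
      eval (p b) (dehomogenise (i b) l) = 0 ∧ eval (p a) (dehomogenise (i a) l) ≠ 0) :
    ∃ r, ∀ a, pointIdeal (p a) ^ r ≤
      truncatedIdeal (dehomogenise (i a) F) (dehomogenise (i a) G) (p a) (r + 1) := by
  classical
  let I := fun r a => truncatedIdeal (dehomogenise (i a) F) (dehomogenise (i a) G) (p a) r
  have hrank := rank_pi_quotient_truncatedIdeal_le hF hG hF0 hrel i p hsep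
  have hfin : ∀ r, Module.Finite k (∀ a, MvPolynomial (Fin 2) k ⧸ I r a) := fun r =>
    Module.rank_lt_aleph0_iff.1 ((hrank r).trans_lt (Cardinal.natCast_lt_aleph0))
  have hle : ∀ r, Module.finrank k (∀ a, MvPolynomial (Fin 2) k ⧸ I r a) ≤ d * e := fun r =>
    Module.finrank_le_of_rank_le (hrank r)
  have hI : ∀ r a, I (r + 1) a ≤ I r a := fun r a =>
    sup_le_sup_left (Ideal.pow_le_pow_right (Nat.le_succ r)) _
  let φ : ∀ r, (∀ a, MvPolynomial (Fin 2) k ⧸ I (r + 1) a) →ₗ[k]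
      (∀ a, MvPolynomial (Fin 2) k ⧸ I r a) := fun r =>
    LinearMap.pi fun a => (Ideal.Quotient.factorₐ k (hI r a)).toLinearMap.comp (LinearMap.proj a)
  have hφ : ∀ r, Function.Surjective (φ r) := fun r w => by
    choose h hh using fun a => Ideal.Quotient.mk_surjective (w a)
    refine ⟨fun a => Ideal.Quotient.mk _ (h a), ?_⟩
    funext a
    rw [← hh a]
    rfl
  obtain ⟨r, hr⟩ : ∃ r, Module.finrank k (∀ a, MvPolynomial (Fin 2) k ⧸ I (r + 1) a) ≤
      Module.finrank k (∀ a, MvPolynomial (Fin 2) k ⧸ I r a) := by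
    by_contra! hlt
    have := (strictMono_nat_of_lt_succ hlt).id_le (d * e + 1)
    exact absurd (this.trans (hle _)) (by simp)
  have hinj : Function.Injective (φ r) :=
    (LinearMap.injective_iff_surjective_of_finrank_eq_finrank
      (hr.antisymm (LinearMap.finrank_le_finrank_of_surjective (hφ r)))).2 (hφ r)
  refine ⟨r, fun a z hz => ?_⟩
  have hzero : (Pi.single a (Ideal.Quotient.mk (I (r + 1) a) z) :
      ∀ a, MvPolynomial (Fin 2) k ⧸ I (r + 1) a) = 0 := by
    apply hinj
    rw [map_zero]
    funext b
    rcases eq_or_ne b a with rfl | hb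
    · simp only [φ, LinearMap.pi_apply, LinearMap.comp_apply, LinearMap.proj_apply,
        Pi.single_eq_same]
      exact Ideal.Quotient.eq_zero_iff_mem.2 (Ideal.mem_sup_right hz)
    · simp [φ, hb]
  have := congrFun hzero a
  rw [Pi.single_eq_same] at this
  exact Ideal.Quotient.eq_zero_iff_mem.1 this

section LocalRing

variable {k : Type*} [Field k] (p : Fin 2 → k)

/-- The ideal of the intersection of two affine plane curves in the local ring at `p`. -/
noncomputable abbrev localIdeal (f g : MvPolynomial (Fin 2) k) : Ideal (PlaneLocalRing p) :=
  Ideal.span {algebraMap (MvPolynomial (Fin 2) k) (PlaneLocalRing p) f,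
    algebraMap (MvPolynomial (Fin 2) k) (PlaneLocalRing p) g}

variable {p}

/-- By Nakayama's lemma, once the truncated local rings have stabilised the truncation loses
nothing. -/
theorem map_pow_le_localIdeal {f g : MvPolynomial (Fin 2) k} {r : ℕ}
    (hr : pointIdeal p ^ r ≤ truncatedIdeal f g p (r + 1)) :
    (pointIdeal p ^ r).map (algebraMap _ (PlaneLocalRing p)) ≤ localIdeal p f g := by
  have h := Ideal.map_mono (f := algebraMap _ (PlaneLocalRing p)) hr
  rw [truncatedIdeal, Ideal.map_sup, Ideal.map_span, Set.image_pair, pow_succ', Ideal.map_mul] at h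
  have hN : IsNoetherianRing (PlaneLocalRing p) :=
    IsLocalization.isNoetherianRing (pointIdeal p).primeCompl _ inferInstance
  refine Submodule.le_of_le_smul_of_le_jacobson_bot (IsNoetherian.noetherian _) ?_ h
  rw [Localization.AtPrime.map_eq_maximalIdeal]
  exact (IsLocalRing.jacobson_eq_maximalIdeal ⊥ bot_ne_top).ge

theorem exists_algebraMap_sub_mem_localIdeal {f g : MvPolynomial (Fin 2) k} {r : ℕ}
    (hr : pointIdeal p ^ r ≤ truncatedIdeal f g p (r + 1)) (z : PlaneLocalRing p) :
    ∃ h : MvPolynomial (Fin 2) k, z - algebraMap _ _ h ∈ localIdeal p f g := by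
  obtain ⟨a, s, rfl⟩ := IsLocalization.exists_mk'_eq (pointIdeal p).primeCompl z
  obtain ⟨u, hu⟩ := exists_mul_sub_one_mem_pointIdeal_pow (p := p) (s := s.1) s.2 r
  refine ⟨a * u, ?_⟩
  have := Ideal.mul_mem_left _ (-IsLocalization.mk' (PlaneLocalRing p) a s)
    (map_pow_le_localIdeal hr (Ideal.mem_map_of_mem _ hu))
  convert this using 1
  have hs := IsLocalization.mk'_spec (PlaneLocalRing p) a s
  rw [map_sub, map_mul, map_mul, map_one]
  linear_combination (algebraMap _ (PlaneLocalRing p) u) * hs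

/-- The truncation of the polynomial ring at `p` surjects onto the local ring of the
intersection, once the truncation order is large. -/
theorem exists_surjective_quotient_truncatedIdeal {f g : MvPolynomial (Fin 2) k} {r : ℕ}
    (hr : pointIdeal p ^ r ≤ truncatedIdeal f g p (r + 1)) :
    ∃ φ : (MvPolynomial (Fin 2) k ⧸ truncatedIdeal f g p r) →ₗ[k]
      (PlaneLocalRing p ⧸ localIdeal p f g), Function.Surjective φ := by
  let ψ : MvPolynomial (Fin 2) k →ₐ[k] (PlaneLocalRing p ⧸ localIdeal p f g) :=
    (Ideal.Quotient.mkₐ k _).comp (IsScalarTower.toAlgHom k _ (PlaneLocalRing p))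
  have hψ : ∀ h, ψ h = Ideal.Quotient.mk _ (algebraMap _ _ h) := fun _ => rfl
  have hker : ∀ h ∈ truncatedIdeal f g p r, ψ h = 0 := by
    intro h hh
    rw [hψ, Ideal.Quotient.eq_zero_iff_mem]
    have := Ideal.mem_map_of_mem (algebraMap _ (PlaneLocalRing p)) hh
    rw [truncatedIdeal, Ideal.map_sup, Ideal.map_span, Set.image_pair] at this
    exact (sup_le le_rfl (map_pow_le_localIdeal hr)) this
  refine ⟨(Ideal.Quotient.liftₐ _ ψ hker).toLinearMap, fun z => ?_⟩
  obtain ⟨z, rfl⟩ := Ideal.Quotient.mk_surjective z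
  obtain ⟨h, hh⟩ := exists_algebraMap_sub_mem_localIdeal hr z
  exact ⟨Ideal.Quotient.mk _ h, ((Ideal.Quotient.mk_eq_mk_iff_sub_mem _ _).2 hh).symm⟩

/-- The length over the local ring of a point with residue field `k` is the dimension over `k`. -/
theorem affineIntersectionMultiplicity_eq_finrank (f g : MvPolynomial (Fin 2) k)
    [Module.Finite k (PlaneLocalRing p ⧸ localIdeal p f g)] :
    affineIntersectionMultiplicity f g p =
      Module.finrank k (PlaneLocalRing p ⧸ localIdeal p f g) := by
  have hsurj : Function.Surjective (algebraMap k (IsLocalRing.ResidueField (PlaneLocalRing p))) := by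
    intro z
    obtain ⟨z, rfl⟩ := IsLocalRing.residue_surjective z
    obtain ⟨a, s, rfl⟩ := IsLocalization.exists_mk'_eq (pointIdeal p).primeCompl z
    have hval : ∀ h : MvPolynomial (Fin 2) k,
        IsLocalRing.residue (PlaneLocalRing p) (algebraMap _ _ h) = algebraMap k _ (eval p h) := by
      intro h
      rw [IsScalarTower.algebraMap_apply k (PlaneLocalRing p) (IsLocalRing.ResidueField _),
        IsScalarTower.algebraMap_apply k (MvPolynomial (Fin 2) k) (PlaneLocalRing p),
        IsLocalRing.ResidueField.algebraMap_eq, ← sub_eq_zero, ← map_sub, ← map_sub,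
        IsLocalRing.residue_eq_zero_iff, ← Localization.AtPrime.map_eq_maximalIdeal]
      refine Ideal.mem_map_of_mem _ ?_
      rw [mem_pointIdeal]
      simp
    have hs : eval p s.1 ≠ 0 := s.2
    refine ⟨eval p a / eval p s.1, ?_⟩
    rw [map_div₀, ← hval, ← hval, div_eq_iff, ← map_mul, IsLocalization.mk'_spec]
    rw [hval]
    exact (map_ne_zero _).2 hs
  have hsurj' : Function.Surjective (algebraMap (IsLocalRing.ResidueField k)
      (IsLocalRing.ResidueField (PlaneLocalRing p))) := fun z => by
    obtain ⟨c, rfl⟩ := hsurj z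
    exact ⟨algebraMap k _ c, (IsScalarTower.algebraMap_apply k _ _ c).symm⟩
  have h := IsLocalRing.length_restrictScalars k (PlaneLocalRing p)
    (PlaneLocalRing p ⧸ localIdeal p f g)
  have hone : Module.length (IsLocalRing.ResidueField k)
      (IsLocalRing.ResidueField (PlaneLocalRing p)) = 1 := by
    rw [Module.length_eq_of_surjective hsurj', Module.length_eq_one]
  rw [hone, mul_one, Module.length_eq_finrank] at h
  exact h.symm

/-- A polynomial that becomes an element of the ideal of the intersection in the local ring at `p`
lies in the truncated ideals of all orders. -/
theorem mem_truncatedIdeal_of_algebraMap_mem {f g : MvPolynomial (Fin 2) k}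
    {h : MvPolynomial (Fin 2) k} (hh : algebraMap _ (PlaneLocalRing p) h ∈ localIdeal p f g)
    (r : ℕ) : h ∈ truncatedIdeal f g p r := by
  rw [localIdeal, ← Set.image_pair, ← Ideal.map_span,
    IsLocalization.mem_map_algebraMap_iff (pointIdeal p).primeCompl] at hh
  obtain ⟨⟨x, s⟩, hxs⟩ := hh
  rw [← map_mul] at hxs
  obtain ⟨c, hc⟩ := IsLocalization.exists_of_eq (M := (pointIdeal p).primeCompl) hxs
  obtain ⟨u, hu⟩ := exists_mul_sub_one_mem_pointIdeal_pow (p := p) (s := c.1 * s.1)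
    (c * s).2 r
  have h1 : u * (c.1 * (h * s.1)) ∈ Ideal.span {f, g} := by
    rw [hc]
    exact Ideal.mul_mem_left _ _ (Ideal.mul_mem_left _ _ x.2)
  have h2 := Ideal.mul_mem_left _ h hu
  have : h = u * (c.1 * (h * s.1)) - h * (u * (c.1 * s.1) - 1) := by ring
  rw [this]
  exact sub_mem (Ideal.mem_sup_left h1) (Ideal.mem_sup_right h2)

/-- Polynomials representing a basis of the local ring of the intersection. -/
theorem exists_forall_sub_sum_mem_truncatedIdeal {f g : MvPolynomial (Fin 2) k} {r : ℕ}
    (hr : pointIdeal p ^ r ≤ truncatedIdeal f g p (r + 1))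
    [Module.Finite k (PlaneLocalRing p ⧸ localIdeal p f g)] :
    ∃ q : Fin (Module.finrank k (PlaneLocalRing p ⧸ localIdeal p f g)) → MvPolynomial (Fin 2) k,
      ∀ (r' : ℕ) (h : MvPolynomial (Fin 2) k), ∃ a : _ → k,
        h - ∑ j, a j • q j ∈ truncatedIdeal f g p r' := by
  let b := Module.finBasis k (PlaneLocalRing p ⧸ localIdeal p f g)
  let ψ : MvPolynomial (Fin 2) k →ₐ[k] (PlaneLocalRing p ⧸ localIdeal p f g) :=
    (Ideal.Quotient.mkₐ k _).comp (IsScalarTower.toAlgHom k _ (PlaneLocalRing p))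
  have hψ : ∀ h, ψ h = Ideal.Quotient.mk _ (algebraMap _ _ h) := fun _ => rfl
  have hsurj : Function.Surjective ψ := fun z => by
    obtain ⟨z, rfl⟩ := Ideal.Quotient.mk_surjective z
    obtain ⟨h, hh⟩ := exists_algebraMap_sub_mem_localIdeal hr z
    exact ⟨h, ((Ideal.Quotient.mk_eq_mk_iff_sub_mem _ _).2 hh).symm⟩
  choose q hq using fun j => hsurj (b j)
  refine ⟨q, fun r' h => ⟨fun j => b.repr (ψ h) j, ?_⟩⟩
  refine mem_truncatedIdeal_of_algebraMap_mem ?_ r'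
  rw [← Ideal.Quotient.eq_zero_iff_mem, ← hψ, map_sub, map_sum]
  simp_rw [map_smul, hq]
  rw [b.sum_repr, sub_self]

end LocalRing

/-- Bézout's inequality for the dimensions of the local rings of the intersection, together with
their finiteness and an order at which all their truncations have stabilised. -/
theorem sum_finrank_localRing_le {k : Type*} [Field k] {d e : ℕ}
    {F G : MvPolynomial (Fin 3) k} (hF : F.IsHomogeneous d) (hG : G.IsHomogeneous e)
    (hF0 : F ≠ 0) (hrel : IsRelPrime F G) {ι : Type*} [Fintype ι]
    (i : ι → Fin 3) (p : ι → Fin 2 → k)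
    (hsep : ∀ a b, a ≠ b → ∃ l : MvPolynomial (Fin 3) k, l.IsHomogeneous 1 ∧
      eval (p b) (dehomogenise (i b) l) = 0 ∧ eval (p a) (dehomogenise (i a) l) ≠ 0) :
    (∃ r, ∀ a, pointIdeal (p a) ^ r ≤
      truncatedIdeal (dehomogenise (i a) F) (dehomogenise (i a) G) (p a) (r + 1)) ∧
    (∀ a, Module.Finite k (PlaneLocalRing (p a) ⧸
      localIdeal (p a) (dehomogenise (i a) F) (dehomogenise (i a) G))) ∧
    ∑ a, Module.finrank k (PlaneLocalRing (p a) ⧸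
      localIdeal (p a) (dehomogenise (i a) F) (dehomogenise (i a) G)) ≤ d * e := by
  obtain ⟨r, hr⟩ := exists_pow_le_truncatedIdeal_succ hF hG hF0 hrel i p hsep
  have hrank := rank_pi_quotient_truncatedIdeal_le hF hG hF0 hrel i p hsep r
  choose φ hφ using fun a => exists_surjective_quotient_truncatedIdeal (hr a)
  have hfin : Module.Finite k (∀ a, MvPolynomial (Fin 2) k ⧸
      truncatedIdeal (dehomogenise (i a) F) (dehomogenise (i a) G) (p a) r) :=
    Module.rank_lt_aleph0_iff.1 (hrank.trans_lt Cardinal.natCast_lt_aleph0)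
  have hfin₁ : ∀ a, Module.Finite k (MvPolynomial (Fin 2) k ⧸
      truncatedIdeal (dehomogenise (i a) F) (dehomogenise (i a) G) (p a) r) := fun a =>
    Module.Finite.of_surjective (LinearMap.proj (φ := fun a => MvPolynomial (Fin 2) k ⧸
      truncatedIdeal (dehomogenise (i a) F) (dehomogenise (i a) G) (p a) r) a)
      (LinearMap.proj_surjective a)
  refine ⟨⟨r, hr⟩, fun a => Module.Finite.of_surjective (φ a) (hφ a), ?_⟩
  refine le_trans ?_ (Module.finrank_le_of_rank_le hrank)
  rw [Module.finrank_pi_fintype]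
  exact Finset.sum_le_sum fun a _ => LinearMap.finrank_le_finrank_of_surjective (hφ a)

/-! ### Points specialising to a given point: the upper bound -/

namespace Specialisation

variable {L K : Type*} [Field L] [Field K] [Algebra L K] (S : Specialisation L K)

theorem res_surjective : Function.Surjective S.res := fun c => ⟨_, S.res_algebraMap c⟩

/-- Evaluation of polynomials over the valuation ring at a family of points with coordinates in
the valuation ring. -/
noncomputable def evalFamily {ι : Type*} (P : ι → Fin 2 → S.ring) :
    MvPolynomial (Fin 2) S.ring →ₐ[S.ring] (ι → S.ring) :=
  aeval fun j a => P a j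

theorem evalFamily_apply {ι : Type*} (P : ι → Fin 2 → S.ring) (h : MvPolynomial (Fin 2) S.ring)
    (a : ι) : S.evalFamily P h a = eval (P a) h := by
  induction h using MvPolynomial.induction_on with
  | C c => simp [evalFamily]
  | add p q hp hq => simp [hp, hq]
  | mul_X p j hp => rw [map_mul, Pi.mul_apply, hp, map_mul]; simp [evalFamily]

theorem pointIdeal_le_map_ker_eval {p : Fin 2 → L} {P : Fin 2 → S.ring}
    (hP : ∀ j, S.res (P j) = p j) :
    pointIdeal p ≤ (RingHom.ker (eval P)).map (MvPolynomial.map S.res) := by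
  have hsurj := MvPolynomial.map_surjective (σ := Fin 2) S.res S.res_surjective
  intro h hh
  obtain ⟨h', rfl⟩ := hsurj h
  rw [Ideal.mem_map_iff_of_surjective _ hsurj]
  refine ⟨h' - C (eval P h'), by simp [RingHom.mem_ker], ?_⟩
  have : S.res (eval P h') = 0 := by
    rw [mem_pointIdeal] at hh
    rw [← hh, eval_map, ← funext hP, MvPolynomial.eval₂_comp]
    rfl
  rw [map_sub, map_C, this, C_0, sub_zero]

/-- A polynomial vanishing to order `#ι` at `p` lifts to a polynomial vanishing at all points of a
family of `#ι` points that specialise to `p`. -/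
theorem exists_lift_of_mem_pointIdeal_pow {p : Fin 2 → L} {ι : Type*} [Fintype ι]
    {P : ι → Fin 2 → S.ring} (hP : ∀ a j, S.res (P a j) = p j) {h : MvPolynomial (Fin 2) L}
    (hh : h ∈ pointIdeal p ^ Fintype.card ι) :
    ∃ h', MvPolynomial.map S.res h' = h ∧ S.evalFamily P h' = 0 := by
  have hsurj := MvPolynomial.map_surjective (σ := Fin 2) S.res S.res_surjective
  have hle : pointIdeal p ^ Fintype.card ι ≤
      (∏ a, RingHom.ker (eval (P a))).map (MvPolynomial.map S.res) := by
    rw [← Finset.card_univ, ← Finset.prod_const, ← Ideal.mapHom_apply, map_prod]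
    exact Finset.prod_le_prod' fun a _ => S.pointIdeal_le_map_ker_eval (hP a)
  obtain ⟨h', hh', rfl⟩ := (Ideal.mem_map_iff_of_surjective _ hsurj).1 (hle hh)
  refine ⟨h', rfl, ?_⟩
  funext a
  rw [evalFamily_apply]
  exact (Ideal.prod_le_inf.trans (Finset.inf_le (Finset.mem_univ a))) hh'

theorem fg_range_evalFamily {ι : Type*} [Finite ι] (P : ι → Fin 2 → S.ring) :
    (Subalgebra.toSubmodule (S.evalFamily P).range).FG := by
  rw [evalFamily, ← Algebra.adjoin_range_eq_range_aeval]
  exact fg_adjoin_of_finite (Set.finite_range _) fun x _ => IsIntegral.of_finite _ x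

/-- Polynomials over `L` that span the local ring of the intersection of `f = 0` and `g = 0` at `p`
lift to polynomials that span, over the valuation ring, the functions on any finite set of common
zeros of a deformation of `(f, g)` specialising to `p`. This is Nakayama's lemma. -/
theorem range_evalFamily_le_span {f' g' : MvPolynomial (Fin 2) S.ring} {p : Fin 2 → L}
    {ι : Type*} [Fintype ι] {P : ι → Fin 2 → S.ring} (hP : ∀ a j, S.res (P a j) = p j)
    (hf : ∀ a, eval (P a) f' = 0) (hg : ∀ a, eval (P a) g' = 0)
    {m : ℕ} (q : Fin m → MvPolynomial (Fin 2) S.ring)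
    (hq : ∀ h, ∃ c : Fin m → L, h - ∑ j, c j • MvPolynomial.map S.res (q j) ∈
      truncatedIdeal (MvPolynomial.map S.res f') (MvPolynomial.map S.res g') p (Fintype.card ι)) :
    Subalgebra.toSubmodule (S.evalFamily P).range ≤
      Submodule.span S.ring (Set.range fun j => S.evalFamily P (q j)) := by
  have hsurj := MvPolynomial.map_surjective (σ := Fin 2) S.res S.res_surjective
  have hker : RingHom.ker S.res ≤ Ideal.jacobson ⊥ := by
    rw [IsLocalRing.jacobson_eq_maximalIdeal ⊥ bot_ne_top]
    exact IsLocalRing.le_maximalIdeal (RingHom.ker_ne_top S.res)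
  refine Submodule.le_of_le_smul_of_le_jacobson_bot (S.fg_range_evalFamily P) hker ?_
  rintro _ ⟨h, rfl⟩
  obtain ⟨c, hc⟩ := hq (MvPolynomial.map S.res h)
  obtain ⟨y, hy, μ, hμ, hsum⟩ := Submodule.mem_sup.1 hc
  obtain ⟨α, β, rfl⟩ := Ideal.mem_span_pair.1 hy
  obtain ⟨α, rfl⟩ := hsurj α
  obtain ⟨β, rfl⟩ := hsurj β
  obtain ⟨μ, rfl, hμ0⟩ := S.exists_lift_of_mem_pointIdeal_pow hP hμ
  choose c' hc' using fun j => S.res_surjective (c j)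
  have hf0 : S.evalFamily P f' = 0 := funext fun a => by rw [evalFamily_apply, hf]; rfl
  have hg0 : S.evalFamily P g' = 0 := funext fun a => by rw [evalFamily_apply, hg]; rfl
  have hz : h - ∑ j, c' j • q j - (α * f' + β * g') - μ ∈ RingHom.ker (MvPolynomial.map S.res) := by
    rw [RingHom.mem_ker, map_sub, map_sub, map_sub, map_sum, map_add, map_mul, map_mul]
    simp_rw [smul_eq_C_mul, map_mul, map_C, hc', ← smul_eq_C_mul]
    rw [← hsum]
    ring
  rw [MvPolynomial.ker_map] at hz
  have hz' : S.evalFamily P (h - ∑ j, c' j • q j - (α * f' + β * g') - μ) ∈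
      RingHom.ker S.res • Subalgebra.toSubmodule (S.evalFamily P).range := by
    have hrange : Subalgebra.toSubmodule (S.evalFamily P).range =
        (⊤ : Submodule S.ring (MvPolynomial (Fin 2) S.ring)).map (S.evalFamily P).toLinearMap := by
      rw [Submodule.map_top]; rfl
    rw [hrange, ← Submodule.map_smul'']
    refine Submodule.mem_map_of_mem (f := (S.evalFamily P).toLinearMap) ?_
    rw [Ideal.smul_top_eq_map]
    exact hz
  have hsplit : S.evalFamily P h = ∑ j, c' j • S.evalFamily P (q j) +
      S.evalFamily P (h - ∑ j, c' j • q j - (α * f' + β * g') - μ) := by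
    simp only [map_sub, map_sum, map_smul, map_add, map_mul, hf0, hg0, hμ0]
    ring
  refine Submodule.mem_sup.2 ⟨_, ?_, _, hz', hsplit.symm⟩
  exact sum_mem fun j _ => Submodule.smul_mem _ _ (Submodule.subset_span ⟨j, rfl⟩)

/-- The number of common zeros of a deformation that specialise to `p` is at most the number of
polynomials needed to span the local ring of the intersection at `p`. -/
theorem card_le_of_forall_mem_truncatedIdeal {f' g' : MvPolynomial (Fin 2) S.ring} {p : Fin 2 → L}
    {ι : Type*} [Fintype ι] {P : ι → Fin 2 → S.ring} (hP : ∀ a j, S.res (P a j) = p j)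
    (hinj : Function.Injective P)
    (hf : ∀ a, eval (P a) f' = 0) (hg : ∀ a, eval (P a) g' = 0)
    {m : ℕ} (q : Fin m → MvPolynomial (Fin 2) L)
    (hq : ∀ h, ∃ c : Fin m → L, h - ∑ j, c j • q j ∈
      truncatedIdeal (MvPolynomial.map S.res f') (MvPolynomial.map S.res g') p (Fintype.card ι)) :
    Fintype.card ι ≤ m := by
  classical
  choose q' hq' using fun j => MvPolynomial.map_surjective (σ := Fin 2) S.res S.res_surjective (q j)
  obtain rfl : (fun j => MvPolynomial.map S.res (q' j)) = q := funext hq'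
  have hle := S.range_evalFamily_le_span hP hf hg q' hq
  let w : Fin m → ι → K := fun j a => (S.evalFamily P (q' j) a : K)
  have htop : Submodule.span K (Set.range w) = ⊤ := by
    rw [eq_top_iff, ← (Pi.basisFun K ι).span_eq, Submodule.span_le]
    rintro _ ⟨a, rfl⟩
    have hex : ∀ b, ∃ j, b ≠ a → P a j ≠ P b j := fun b => by
      by_cases hb : b = a
      · exact ⟨0, fun h => absurd hb h⟩
      · obtain ⟨j, hj⟩ := Function.ne_iff.1 (hinj.ne (Ne.symm hb))
        exact ⟨j, fun _ => hj⟩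
    choose j hj using hex
    -- a polynomial vanishing at all points of the family but the `a`-th
    let h : MvPolynomial (Fin 2) S.ring := ∏ b ∈ Finset.univ.erase a, (X (j b) - C (P b (j b)))
    have ha : eval (P a) h ≠ 0 := by
      rw [map_prod, Finset.prod_ne_zero_iff]
      intro b hb
      rw [map_sub, eval_X, eval_C, sub_ne_zero]
      exact hj b (Finset.ne_of_mem_erase hb)
    have hb : ∀ b, b ≠ a → eval (P b) h = 0 := by
      intro b hb
      rw [map_prod]
      refine Finset.prod_eq_zero (Finset.mem_erase.2 ⟨hb, Finset.mem_univ b⟩) ?_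
      simp
    obtain ⟨c, hc⟩ := (Submodule.mem_span_range_iff_exists_fun _).1
      (hle ⟨h, rfl⟩ : S.evalFamily P h ∈ _)
    have haK : ((eval (P a) h : S.ring) : K) ≠ 0 := by simpa using ha
    have hsingle : Pi.basisFun K ι a =
        ((eval (P a) h : S.ring) : K)⁻¹ • ∑ j, (c j : K) • w j := by
      funext b
      have hcb := congrArg (fun z : S.ring => (z : K)) (congrFun hc b)
      simp only [evalFamily_apply, Finset.sum_apply, Pi.smul_apply, smul_eq_mul] at hcb
      push_cast at hcb
      simp only [Pi.basisFun_apply, Pi.smul_apply, Finset.sum_apply, smul_eq_mul, w,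
        evalFamily_apply, hcb]
      rcases eq_or_ne b a with rfl | hba
      · rw [Pi.single_eq_same, inv_mul_cancel₀ haK]
      · rw [Pi.single_eq_of_ne hba, hb b hba]
        simp
    rw [hsingle]
    exact Submodule.smul_mem _ _ (sum_mem fun j _ =>
      Submodule.smul_mem _ _ (Submodule.subset_span ⟨j, rfl⟩))
  have := finrank_range_le_card (R := K) w
  rwa [Set.finrank, htop, finrank_top, Module.finrank_fintype_fun_eq_card, Fintype.card_fin] at this

end Specialisation

/-! ### Lifting roots along a place -/

section Valuation

variable {K : Type*} [Field K] (V : ValuationSubring K)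

/-- If no `α` reduces to the same element as `γ`, the value of `∏ (X - α)` at `γ` has the largest
valuation that its coefficients could have. -/
theorem valuation_coeff_prod_X_sub_C_le {γ : K} (hγ : V.valuation γ ≤ 1) (s : Multiset K)
    (hs : ∀ α ∈ s, 1 ≤ V.valuation (γ - α)) (n : ℕ) :
    V.valuation ((s.map fun α => Polynomial.X - Polynomial.C α).prod.coeff n) ≤
      (s.map fun α => V.valuation (γ - α)).prod := by
  induction s using Multiset.induction_on generalizing n with
  | empty =>
    simp only [Multiset.map_zero, Multiset.prod_zero, Polynomial.coeff_one]
    split_ifs <;> simp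
  | cons α s ih =>
    have hα : 1 ≤ V.valuation (γ - α) := hs α (Multiset.mem_cons_self α s)
    have hα' : V.valuation α ≤ V.valuation (γ - α) := by
      calc V.valuation α = V.valuation (γ - (γ - α)) := by rw [sub_sub_cancel]
        _ ≤ max (V.valuation γ) (V.valuation (γ - α)) := V.valuation.map_sub _ _
        _ ≤ V.valuation (γ - α) := max_le (hγ.trans hα) le_rfl
    have ih' := ih fun β hβ => hs β (Multiset.mem_cons_of_mem hβ)
    rw [Multiset.map_cons, Multiset.prod_cons, Multiset.map_cons, Multiset.prod_cons, sub_mul,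
      Polynomial.coeff_sub, Polynomial.coeff_C_mul]
    refine (V.valuation.map_sub _ _).trans (max_le ?_ ?_)
    · cases n with
      | zero => simp
      | succ n =>
        rw [Polynomial.coeff_X_mul]
        exact (ih' n).trans (le_mul_of_one_le_left' hα)
    · rw [map_mul]
      exact mul_le_mul' hα' (ih' n)

/-- Roots lift along a place of an algebraically closed field: if the reduction of a polynomial is
nonzero and vanishes at the reduction of `γ`, then some root reduces to the same element as `γ`. -/
theorem exists_isRoot_valuation_sub_lt_one [IsAlgClosed K] {r : Polynomial K} {n : ℕ}
    (hr : 1 ≤ V.valuation (r.coeff n)) {γ : K} (hγ : V.valuation γ ≤ 1)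
    (hrγ : V.valuation (r.eval γ) < 1) : ∃ ρ, r.IsRoot ρ ∧ V.valuation (γ - ρ) < 1 := by
  by_contra! h
  have hr0 : r ≠ 0 := by rintro rfl; simp at hr
  have hsplit := (IsAlgClosed.splits r).eq_prod_roots
  have hle := valuation_coeff_prod_X_sub_C_le V hγ r.roots
    (fun α hα => h α ((Polynomial.mem_roots hr0).1 hα)) n
  have hev : V.valuation (r.eval γ) = V.valuation r.leadingCoeff *
      (r.roots.map fun α => V.valuation (γ - α)).prod := by
    conv_lhs => rw [hsplit]
    rw [Polynomial.eval_mul, Polynomial.eval_C, map_mul, Polynomial.eval_multiset_prod,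
      map_multiset_prod, Multiset.map_map, Multiset.map_map]
    simp
  have hco : V.valuation (r.coeff n) ≤ V.valuation (r.eval γ) := by
    rw [hev]
    conv_lhs => rw [hsplit]
    rw [Polynomial.coeff_C_mul, map_mul]
    exact mul_le_mul' le_rfl hle
  exact absurd (hr.trans hco) (not_le.2 hrγ)

/-- Any specialisation `φ` of a subring `ψ(U)` of a field `K` extends to a place of `K`. -/
theorem exists_valuationSubring_valuation_lt_one_iff {U k : Type*} [CommRing U] [Field k]
    (φ : U →+* k) (ψ : U →+* K) (hψ : Function.Injective ψ) :
    ∃ V : ValuationSubring K, ∀ u, V.valuation (ψ u) ≤ 1 ∧ (V.valuation (ψ u) < 1 ↔ φ u = 0) := by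
  have : (RingHom.ker φ).IsPrime := RingHom.ker_isPrime φ
  let Ψ : Localization.AtPrime (RingHom.ker φ) →+* K :=
    IsLocalization.lift (M := (RingHom.ker φ).primeCompl) (g := ψ) fun s => by
      refine IsUnit.mk0 _ fun h => s.2 ?_
      have : (s : U) = 0 := hψ (by rw [h, map_zero])
      simp [this]
  have hΨ : ∀ u, Ψ (algebraMap U _ u) = ψ u := fun u => IsLocalization.lift_eq _ u
  obtain ⟨V, hV, hloc⟩ := IsLocalRing.exists_factor_valuationRing Ψ
  refine ⟨V, fun u => ?_⟩
  have hmem : ψ u ∈ V := hΨ u ▸ hV (algebraMap U _ u)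
  refine ⟨(V.valuation_le_one_iff _).2 hmem, ?_⟩
  have h1 : V.valuation (ψ u) = 1 ↔ IsUnit (⟨ψ u, hmem⟩ : V) := (V.valuation_eq_one_iff ⟨ψ u, hmem⟩).symm
  have h2 : IsUnit (⟨ψ u, hmem⟩ : V) ↔
      IsUnit (algebraMap U (Localization.AtPrime (RingHom.ker φ)) u) := by
    have : (⟨ψ u, hmem⟩ : V) = Ψ.codRestrict V.toSubring hV (algebraMap U _ u) :=
      Subtype.ext (hΨ u).symm
    rw [this]
    exact isUnit_map_iff (Ψ.codRestrict V.toSubring hV) _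
  have h3 : IsUnit (algebraMap U (Localization.AtPrime (RingHom.ker φ)) u) ↔ φ u ≠ 0 :=
    IsLocalization.AtPrime.isUnit_to_map_iff _ (RingHom.ker φ) u
  rw [((V.valuation_le_one_iff _).2 hmem).lt_iff_ne, Ne, h1, h2, h3, not_not]

end Valuation

/-! ### Elimination of a variable -/

section Elimination

theorem map_restrictToLine {σ A B : Type*} [CommRing A] [CommRing B] (φ : A →+* B) (w v : σ → A)
    (P : MvPolynomial σ A) :
    (restrictToLine w v P).map φ = restrictToLine (φ ∘ w) (φ ∘ v) (P.map φ) := by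
  induction P using MvPolynomial.induction_on with
  | C a => simp [restrictToLine, Polynomial.algebraMap_eq]
  | add p q hp hq => simp [hp, hq]
  | mul_X p i hp =>
    rw [map_mul, Polynomial.map_mul, hp, map_mul, map_mul]
    simp [restrictToLine]

/-- The polynomial in `t` obtained from two forms of degrees `d` and `e` in the coordinates
`(1, t, y)` by eliminating `y`. -/
noncomputable def eliminant {A : Type*} [CommRing A] (d e : ℕ) (P Q : MvPolynomial (Fin 3) A) :
    Polynomial A :=
  Polynomial.resultant
    (restrictToLine ![1, Polynomial.X, 0] ![0, 0, 1] (P.map Polynomial.C))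
    (restrictToLine ![1, Polynomial.X, 0] ![0, 0, 1] (Q.map Polynomial.C)) d e

theorem map_eliminant {A B : Type*} [CommRing A] [CommRing B] (φ : A →+* B) (d e : ℕ)
    (P Q : MvPolynomial (Fin 3) A) :
    (eliminant d e P Q).map φ = eliminant d e (P.map φ) (Q.map φ) := by
  have hmap : ∀ P : MvPolynomial (Fin 3) A, (P.map Polynomial.C).map (Polynomial.mapRingHom φ) =
      (P.map φ).map Polynomial.C := fun P => by
    refine (MvPolynomial.map_map _ _ _).trans (Eq.trans ?_ (MvPolynomial.map_map _ _ _).symm)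
    rw [Polynomial.mapRingHom_comp_C]
  have hw : ⇑(Polynomial.mapRingHom φ) ∘ ![1, Polynomial.X, 0] = ![1, Polynomial.X, 0] := by
    funext i; fin_cases i <;> simp
  have hv : ⇑(Polynomial.mapRingHom φ) ∘ ![0, 0, 1] = ![0, 0, 1] := by
    funext i; fin_cases i <;> simp
  rw [eliminant, eliminant, ← Polynomial.coe_mapRingHom, ← Polynomial.resultant_map_map,
    map_restrictToLine, map_restrictToLine, hmap, hmap, hw, hv]

theorem eval_eliminant {A : Type*} [CommRing A] (d e : ℕ) (P Q : MvPolynomial (Fin 3) A) (t : A) :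
    (eliminant d e P Q).eval t =
      Polynomial.resultant (restrictToLine ![1, t, 0] ![0, 0, 1] P)
        (restrictToLine ![1, t, 0] ![0, 0, 1] Q) d e := by
  have hmap : ∀ P : MvPolynomial (Fin 3) A,
      (P.map Polynomial.C).map (Polynomial.evalRingHom t) = P := fun P => by
    refine (MvPolynomial.map_map _ _ _).trans ?_
    rw [show (Polynomial.evalRingHom t).comp Polynomial.C = RingHom.id A by ext; simp,
      MvPolynomial.map_id]
  have hw : ⇑(Polynomial.evalRingHom t) ∘ ![1, Polynomial.X, 0] = ![1, t, 0] := by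
    funext i; fin_cases i <;> simp
  have hv : ⇑(Polynomial.evalRingHom t) ∘ ![0, 0, 1] = ![0, 0, 1] := by
    funext i; fin_cases i <;> simp
  rw [eliminant, ← Polynomial.coe_evalRingHom, ← Polynomial.resultant_map_map,
    map_restrictToLine, map_restrictToLine, hmap, hmap, hw, hv]

theorem natDegree_restrictToLine_of_isHomogeneous {k : Type*} [CommRing k] {d : ℕ}
    {P : MvPolynomial (Fin 3) k} (hP : P.IsHomogeneous d) {v : Fin 3 → k} (hv : eval v P ≠ 0)
    (w : Fin 3 → k) : (restrictToLine w v P).natDegree = d := by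
  refine le_antisymm ((natDegree_restrictToLine_le w v P).trans hP.totalDegree_le)
    (Polynomial.le_natDegree_of_ne_zero ?_)
  rwa [coeff_restrictToLine_of_isHomogeneous w v hP]

/-- The eliminant of two curves that avoid the centre of projection vanishes exactly at the
projections of their common points. -/
theorem eval_eliminant_eq_zero_iff {k : Type*} [Field k] [IsAlgClosed k] {d e : ℕ}
    {P Q : MvPolynomial (Fin 3) k} (hP : P.IsHomogeneous d) (hQ : Q.IsHomogeneous e)
    (hP0 : eval ![0, 0, 1] P ≠ 0) (hQ0 : eval ![0, 0, 1] Q ≠ 0) (t : k) :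
    (eliminant d e P Q).eval t = 0 ↔ ∃ y, eval ![1, t, y] P = 0 ∧ eval ![1, t, y] Q = 0 := by
  have hdP := natDegree_restrictToLine_of_isHomogeneous hP hP0 ![1, t, 0]
  have hdQ := natDegree_restrictToLine_of_isHomogeneous hQ hQ0 ![1, t, 0]
  have hne : restrictToLine ![1, t, 0] ![0, 0, 1] P ≠ 0 := fun h => hP0 <| by
    rw [← coeff_restrictToLine_of_isHomogeneous ![1, t, 0] _ hP, h, Polynomial.coeff_zero]
  have hres := Polynomial.resultant_eq_zero_iff (f := restrictToLine ![1, t, 0] ![0, 0, 1] P)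
    (g := restrictToLine ![1, t, 0] ![0, 0, 1] Q)
  rw [hdP, hdQ] at hres
  have hline : ∀ y : k, ![1, t, 0] + y • ![0, 0, 1] = ![1, t, y] := fun y => by
    ext i; fin_cases i <;> simp
  rw [eval_eliminant, hres, Polynomial.isCoprime_iff_aeval_ne_zero_of_isAlgClosed k k]
  simp [hne, eval_restrictToLine, hline, -Matrix.smul_cons, -Matrix.cons_add]

end Elimination

/-! ### Common zeros of two generic forms -/

/-- Over an infinite field, `d` elements and `e` elements with all `d e` differences distinct. -/
theorem exists_injective_sub (k : Type*) [Field k] [Infinite k] (d e : ℕ) :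
    ∃ (b : Fin d → k) (c : Fin e → k),
      Function.Injective fun ij : Fin d × Fin e => b ij.1 - c ij.2 := by
  classical
  let D : Fin d × Fin e → MvPolynomial (Fin d ⊕ Fin e) k := fun ij =>
    X (Sum.inl ij.1) - X (Sum.inr ij.2)
  have hD : ∀ p q, p ≠ q → D p - D q ≠ 0 := by
    rintro ⟨i, j⟩ ⟨i', j'⟩ hne h
    by_cases hi : i = i'
    · subst hi
      have hj : j ≠ j' := by rintro rfl; exact hne rfl
      have := congrArg (eval (Pi.single (Sum.inr j) (1 : k))) h
      simp [D, hj.symm] at this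
    · have := congrArg (eval (Pi.single (Sum.inl i) (1 : k))) h
      simp [D, Ne.symm hi] at this
  have hprod : ∏ pq ∈ (Finset.univ : Finset (Fin d × Fin e)).offDiag, (D pq.1 - D pq.2) ≠ 0 :=
    Finset.prod_ne_zero_iff.2 fun pq hpq => hD _ _ (Finset.mem_offDiag.1 hpq).2.2
  obtain ⟨x, hx⟩ : ∃ x, eval x (∏ pq ∈ (Finset.univ : Finset (Fin d × Fin e)).offDiag,
      (D pq.1 - D pq.2)) ≠ 0 := by
    by_contra! h
    exact hprod (MvPolynomial.funext fun x => by simpa using h x)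
  rw [map_prod, Finset.prod_ne_zero_iff] at hx
  refine ⟨fun i => x (Sum.inl i), fun j => x (Sum.inr j), fun p q hpq => ?_⟩
  by_contra hne
  refine hx (p, q) (Finset.mem_offDiag.2 ⟨Finset.mem_univ _, Finset.mem_univ _, hne⟩) ?_
  simpa [D, sub_eq_zero] using hpq

section Coefficients

instance finite_exponents (d : ℕ) : Finite {m : Fin 3 →₀ ℕ // m.degree = d} := by
  classical
  refine Set.Finite.to_subtype (s := {m : Fin 3 →₀ ℕ | m.degree = d}) ?_
  refine ((Finset.univ : Finset (Fin 3)).finsuppAntidiag d).finite_toSet.subset fun m hm => ?_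
  simpa [Finset.mem_finsuppAntidiag, Finsupp.degree_eq_sum] using hm

noncomputable instance fintype_exponents (d : ℕ) : Fintype {m : Fin 3 →₀ ℕ // m.degree = d} :=
  Fintype.ofFinite _

/-- The form of degree `d` with given coefficients. -/
noncomputable def formOfCoeffs {A : Type*} [CommSemiring A] (d : ℕ)
    (c : {m : Fin 3 →₀ ℕ // m.degree = d} → A) : MvPolynomial (Fin 3) A :=
  ∑ m, monomial m.1 (c m)

theorem isHomogeneous_formOfCoeffs {A : Type*} [CommSemiring A] (d : ℕ)
    (c : {m : Fin 3 →₀ ℕ // m.degree = d} → A) : (formOfCoeffs d c).IsHomogeneous d :=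
  IsHomogeneous.sum _ _ _ fun m _ => isHomogeneous_monomial _ m.2

theorem map_formOfCoeffs {A B : Type*} [CommSemiring A] [CommSemiring B] (φ : A →+* B) (d : ℕ)
    (c : {m : Fin 3 →₀ ℕ // m.degree = d} → A) :
    (formOfCoeffs d c).map φ = formOfCoeffs d fun m => φ (c m) := by
  simp [formOfCoeffs]

theorem coeff_formOfCoeffs {A : Type*} [CommSemiring A] {d : ℕ}
    (c : {m : Fin 3 →₀ ℕ // m.degree = d} → A) (m : {m : Fin 3 →₀ ℕ // m.degree = d}) :
    (formOfCoeffs d c).coeff m.1 = c m := by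
  classical
  rw [formOfCoeffs, coeff_sum, Finset.sum_eq_single m]
  · simp
  · intro n _ hn
    rw [coeff_monomial, if_neg fun h => hn (Subtype.ext h)]
  · simp

theorem formOfCoeffs_coeff {A : Type*} [CommSemiring A] {d : ℕ} {P : MvPolynomial (Fin 3) A}
    (hP : P.IsHomogeneous d) : formOfCoeffs d (fun m => P.coeff m.1) = P := by
  ext m
  by_cases hm : m.degree = d
  · exact coeff_formOfCoeffs _ ⟨m, hm⟩
  · rw [hP.coeff_eq_zero hm, (isHomogeneous_formOfCoeffs d _).coeff_eq_zero hm]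

end Coefficients

/-- Two pencils of parallel lines, in the affine chart where the first coordinate is `1`, meeting
in points whose projections from `(0 : 0 : 1)` are distinct. -/
theorem exists_forms_with_distinct_projections (k : Type*) [Field k] [IsAlgClosed k] (d e : ℕ) :
    ∃ (F G : MvPolynomial (Fin 3) k) (γ : Fin d × Fin e → k), F.IsHomogeneous d ∧
      G.IsHomogeneous e ∧ eval ![0, 0, 1] F = 1 ∧ eval ![0, 0, 1] G = 1 ∧ Function.Injective γ ∧
      eliminant d e F G ≠ 0 ∧ ∀ ij, (eliminant d e F G).eval (γ ij) = 0 := by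
  have := IsAlgClosed.instInfinite (K := k)
  obtain ⟨b, c, hbc⟩ := exists_injective_sub k d e
  let F : MvPolynomial (Fin 3) k := ∏ i, (X 2 - C (b i) * X 0)
  let G : MvPolynomial (Fin 3) k := ∏ j, (X 2 - X 1 - C (c j) * X 0)
  have hF : F.IsHomogeneous d := by
    have := IsHomogeneous.prod Finset.univ (fun i => (X 2 - C (b i) * X 0 : MvPolynomial (Fin 3) k))
      (fun _ => 1) fun i _ => (isHomogeneous_X k 2).sub (isHomogeneous_C_mul_X (b i) 0)
    simpa using this
  have hG : G.IsHomogeneous e := by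
    have := IsHomogeneous.prod Finset.univ
      (fun j => (X 2 - X 1 - C (c j) * X 0 : MvPolynomial (Fin 3) k)) (fun _ => 1)
      fun j _ => ((isHomogeneous_X k 2).sub (isHomogeneous_X k 1)).sub
        (isHomogeneous_C_mul_X (c j) 0)
    simpa using this
  have hF1 : eval ![0, 0, 1] F = 1 := by simp [F, map_prod]
  have hG1 : eval ![0, 0, 1] G = 1 := by simp [G, map_prod]
  have hiff : ∀ t, (eliminant d e F G).eval t = 0 ↔ ∃ ij : Fin d × Fin e, b ij.1 - c ij.2 = t := by
    intro t
    rw [eval_eliminant_eq_zero_iff hF hG (by rw [hF1]; exact one_ne_zero)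
      (by rw [hG1]; exact one_ne_zero)]
    simp only [F, G, map_prod, Finset.prod_eq_zero_iff, Finset.mem_univ, true_and]
    constructor
    · rintro ⟨y, ⟨i, hi⟩, ⟨j, hj⟩⟩
      refine ⟨(i, j), ?_⟩
      simp at hi hj
      linear_combination hj - hi
    · rintro ⟨⟨i, j⟩, rfl⟩
      exact ⟨b i, ⟨i, by simp⟩, ⟨j, by simp⟩⟩
  refine ⟨F, G, _, hF, hG, hF1, hG1, hbc, fun h0 => ?_, fun ij => (hiff _).2 ⟨ij, rfl⟩⟩
  refine Set.infinite_univ (α := k) ((Set.finite_range fun ij : Fin d × Fin e =>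
    b ij.1 - c ij.2).subset fun t _ => (hiff t).1 (by rw [h0, Polynomial.eval_zero]))

theorem map_eval_centre {A B : Type*} [CommRing A] [CommRing B] (φ : A →+* B)
    (P : MvPolynomial (Fin 3) A) : φ (eval ![0, 0, 1] P) = eval ![0, 0, 1] (P.map φ) := by
  rw [MvPolynomial.map_eval]
  congr 2
  funext i
  fin_cases i <;> simp

/-- Two forms with algebraically independent coefficients have at least `d e` common zeros. -/
theorem exists_finset_card_eq_mul_of_algebraicIndependent {L K : Type*} [Field L] [IsAlgClosed L]
    [Field K] [IsAlgClosed K] [Algebra L K] {d e : ℕ} {F G : MvPolynomial (Fin 3) K}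
    (hF : F.IsHomogeneous d) (hG : G.IsHomogeneous e)
    (hgen : AlgebraicIndependent L
      (Sum.elim (fun m : {m : Fin 3 →₀ ℕ // m.degree = d} => F.coeff m.1)
        (fun m : {m : Fin 3 →₀ ℕ // m.degree = e} => G.coeff m.1))) :
    ∃ T : Finset (ℙ K (Fin 3 → K)), ↑T ⊆ commonZeros F G ∧ T.card = d * e := by
  classical
  obtain ⟨F₀, G₀, γ, hF₀, hG₀, hF₁, hG₁, hγ, hne, hroot⟩ := exists_forms_with_distinct_projections L d e
  let ι := {m : Fin 3 →₀ ℕ // m.degree = d} ⊕ {m : Fin 3 →₀ ℕ // m.degree = e}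
  let U := MvPolynomial ι L
  -- the universal pair of forms, of which the two pairs at hand are specialisations
  let Fu : MvPolynomial (Fin 3) U := formOfCoeffs d fun m => X (Sum.inl m)
  let Gu : MvPolynomial (Fin 3) U := formOfCoeffs e fun m => X (Sum.inr m)
  let ψ : U →ₐ[L] K := aeval (Sum.elim (fun m : {m : Fin 3 →₀ ℕ // m.degree = d} => F.coeff m.1)
        (fun m : {m : Fin 3 →₀ ℕ // m.degree = e} => G.coeff m.1))
  let φ : U →ₐ[L] L := aeval (Sum.elim
        (fun m : {m : Fin 3 →₀ ℕ // m.degree = d} => F₀.coeff m.1)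
        (fun m : {m : Fin 3 →₀ ℕ // m.degree = e} => G₀.coeff m.1))
  have hψF : Fu.map (ψ : U →+* K) = F := by
    rw [map_formOfCoeffs, ← formOfCoeffs_coeff hF]
    congr 1; funext m; exact aeval_X _ _
  have hψG : Gu.map (ψ : U →+* K) = G := by
    rw [map_formOfCoeffs, ← formOfCoeffs_coeff hG]
    congr 1; funext m; exact aeval_X _ _
  have hφF : Fu.map (φ : U →+* L) = F₀ := by
    rw [map_formOfCoeffs, ← formOfCoeffs_coeff hF₀]
    congr 1; funext m; exact aeval_X _ _
  have hφG : Gu.map (φ : U →+* L) = G₀ := by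
    rw [map_formOfCoeffs, ← formOfCoeffs_coeff hG₀]
    congr 1; funext m; exact aeval_X _ _
  have hψinj : Function.Injective (ψ : U →+* K) := hgen
  obtain ⟨V, hV⟩ := exists_valuationSubring_valuation_lt_one_iff (φ : U →+* L) (ψ : U →+* K) hψinj
  have hlead : ∀ (P : MvPolynomial (Fin 3) U), eval ![0, 0, 1] (P.map (φ : U →+* L)) ≠ 0 →
      eval ![0, 0, 1] (P.map (ψ : U →+* K)) ≠ 0 := by
    intro P hP h
    rw [← map_eval_centre] at h hP
    rw [hψinj (h.trans (map_zero _).symm), map_zero] at hP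
    exact hP rfl
  have hF0 : eval ![0, 0, 1] F ≠ 0 := by
    rw [← hψF]; exact hlead Fu (by rw [hφF, hF₁]; exact one_ne_zero)
  have hG0 : eval ![0, 0, 1] G ≠ 0 := by
    rw [← hψG]; exact hlead Gu (by rw [hφG, hG₁]; exact one_ne_zero)
  obtain ⟨n, hn⟩ : ∃ n, (eliminant d e F₀ G₀).coeff n ≠ 0 := by
    by_contra! h
    exact hne (Polynomial.ext fun n => by rw [h, Polynomial.coeff_zero])
  have hn' : 1 ≤ V.valuation ((eliminant d e F G).coeff n) := by
    rw [← hφF, ← hφG, ← map_eliminant, Polynomial.coeff_map] at hn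
    rw [← hψF, ← hψG, ← map_eliminant, Polynomial.coeff_map]
    exact not_lt.1 fun h => hn ((hV _).2.1 h)
  have hC : ∀ c : L, ψ (C c) = algebraMap L K c := fun c => aeval_C _ _
  have hCφ : ∀ c : L, φ (C c) = c := fun c => aeval_C _ _
  have hlift : ∀ ij, ∃ ρ, (eliminant d e F G).IsRoot ρ ∧
      V.valuation (algebraMap L K (γ ij) - ρ) < 1 := by
    intro ij
    refine exists_isRoot_valuation_sub_lt_one V hn' ?_ ?_
    · rw [← hC]; exact (hV _).1
    · have h1 : (eliminant d e F G).eval (algebraMap L K (γ ij)) =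
          (ψ : U →+* K) ((eliminant d e Fu Gu).eval (C (γ ij))) := by
        rw [← hψF, ← hψG, ← map_eliminant, ← hC]
        exact Polynomial.eval_map_apply _ _
      have h2 : (eliminant d e F₀ G₀).eval (γ ij) =
          (φ : U →+* L) ((eliminant d e Fu Gu).eval (C (γ ij))) := by
        rw [← hφF, ← hφG, ← map_eliminant]
        conv_lhs => rw [← hCφ (γ ij)]
        exact Polynomial.eval_map_apply _ _
      rw [h1, (hV _).2, ← h2, hroot]
  choose ρ hρ hργ using hlift
  have hρinj : Function.Injective ρ := by
    intro a b hab
    apply hγ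
    have h1 : V.valuation ((ψ : U →+* K) (C (γ a - γ b))) < 1 := by
      have h2 : (ψ : U →+* K) (C (γ a - γ b)) =
          (algebraMap L K (γ a) - ρ a) - (algebraMap L K (γ b) - ρ b) := by
        rw [hab]
        simp [hC]
      rw [h2]
      exact (V.valuation.map_sub _ _).trans_lt (max_lt (hργ a) (hργ b))
    have h3 := (hV _).2.1 h1
    rw [RingHom.coe_coe, hCφ, sub_eq_zero] at h3
    exact h3
  choose y hyF hyG using fun ij => (eval_eliminant_eq_zero_iff hF hG hF0 hG0 (ρ ij)).1 (hρ ij)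
  have hv : ∀ ij, (![1, ρ ij, y ij] : Fin 3 → K) ≠ 0 := fun ij h => by
    simpa using congrFun h 0
  have hinj : Function.Injective fun ij => Projectivization.mk K _ (hv ij) := by
    intro a b hab
    obtain ⟨c, hc⟩ := (Projectivization.mk_eq_mk_iff' _ _ _ _ _).1 hab
    have h0 := congrFun hc 0
    have h1 := congrFun hc 1
    simp at h0 h1
    rw [h0, one_mul] at h1
    exact (hρinj h1.symm)
  refine ⟨Finset.univ.map ⟨_, hinj⟩, ?_, by simp⟩
  intro z hz
  obtain ⟨ij, -, rfl⟩ := Finset.mem_map.1 (Finset.mem_coe.1 hz)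
  exact (mk_mem_commonZeros_iff hF hG (hv ij)).2 ⟨hyF ij, hyG ij⟩

/-! ### Specialisation of forms and points -/

namespace Specialisation

variable {L K : Type*} [Field L] [Field K] [Algebra L K] (S : Specialisation L K)

theorem isUnit_of_res_ne_zero {z : S.ring} (hz : S.res z ≠ 0) : IsUnit z := by
  have hmax : (RingHom.ker S.res).IsMaximal := RingHom.ker_isMaximal_of_surjective _ S.res_surjective
  by_contra h
  have : z ∈ IsLocalRing.maximalIdeal S.ring := h
  rw [← IsLocalRing.eq_maximalIdeal hmax] at this
  exact hz this

/-- Since `K` is the field of fractions of the valuation ring, the valuation ring contains a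
transcendence basis of `K` over `L`. -/
theorem exists_algebraicIndependent_mem_ring (htr : Cardinal.aleph0 ≤ Algebra.trdeg L K)
    (ι : Type) [Finite ι] :
    ∃ b : ι → K, AlgebraicIndependent L b ∧ ∀ a, b a ∈ S.ring := by
  have halg : Algebra.IsAlgebraic (Algebra.adjoin L (S.ring : Set K)) K := by
    refine ⟨fun z => ?_⟩
    have hmem : ∀ w ∈ S.ring, IsAlgebraic (Algebra.adjoin L (S.ring : Set K)) w := fun w hw =>
      isAlgebraic_algebraMap (⟨w, Algebra.subset_adjoin hw⟩ : Algebra.adjoin L (S.ring : Set K))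
    rcases S.ring.mem_or_inv_mem z with h | h
    · exact hmem z h
    · exact IsAlgebraic.inv_iff.1 (hmem _ h)
  obtain ⟨t, htS, ht⟩ := exists_isTranscendenceBasis_subset (R := L) (S.ring : Set K)
  have hinf : Infinite t := by
    rw [← Cardinal.aleph0_le_mk_iff, ht.cardinalMk_eq_trdeg]
    exact htr
  obtain ⟨n, ⟨f⟩⟩ := Finite.exists_equiv_fin ι
  let g : ι ↪ t := f.toEmbedding.trans (Fin.valEmbedding.trans (Infinite.natEmbedding t))
  exact ⟨fun a => (g a : K), ht.1.comp g g.injective, fun a => htS (g a).2⟩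

/-- Algebraically independent elements can be chosen with any given specialisations. -/
theorem exists_algebraicIndependent_res_eq (htr : Cardinal.aleph0 ≤ Algebra.trdeg L K)
    (ι : Type) [Finite ι] (c : ι → L) :
    ∃ b : ι → S.ring, AlgebraicIndependent L (fun a => (b a : K)) ∧ ∀ a, S.res (b a) = c a := by
  obtain ⟨b, hb, hbS⟩ := S.exists_algebraicIndependent_mem_ring htr ι
  -- translate by constants; this is an automorphism of the polynomial ring
  let τ : ι → L := fun a => c a - S.res ⟨b a, hbS a⟩
  refine ⟨fun a => ⟨b a, hbS a⟩ + ⟨algebraMap L K (τ a), S.algebraMap_mem _⟩, ?_, fun a => ?_⟩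
  · have hinj : Function.Injective (aeval (fun a => X a + C (τ a)) :
        MvPolynomial ι L →ₐ[L] MvPolynomial ι L) := by
      refine Function.LeftInverse.injective (g := (aeval (fun a => X a - C (τ a)) :
        MvPolynomial ι L →ₐ[L] MvPolynomial ι L)) fun P => ?_
      rw [← AlgHom.comp_apply]
      conv_rhs => rw [← AlgHom.id_apply (R := L) P]
      congr 1
      ext a
      simp [algebraMap_eq]
    have hcomp : (aeval fun a => b a + algebraMap L K (τ a) : MvPolynomial ι L →ₐ[L] K) =
        (aeval b).comp (aeval fun a => X a + C (τ a)) := by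
      ext a
      simp
    refine (algebraicIndependent_iff_injective_aeval).2 ?_
    change Function.Injective (aeval fun a => b a + algebraMap L K (τ a) : MvPolynomial ι L →ₐ[L] K)
    rw [hcomp, AlgHom.coe_comp]
    exact Function.Injective.comp hb hinj
  · rw [map_add, S.res_algebraMap]
    simp [τ]

theorem formTo_formOfCoeffs {d : ℕ} {F : MvPolynomial (Fin 3) L} (hF : F.IsHomogeneous d)
    (b : {m : Fin 3 →₀ ℕ // m.degree = d} → S.ring) (hb : ∀ m, S.res (b m) = F.coeff m.1) :
    S.FormTo (formOfCoeffs d fun m => (b m : K)) F := by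
  intro m
  by_cases hm : m.degree = d
  · have h : (formOfCoeffs d fun m => (b m : K)).coeff m = b ⟨m, hm⟩ :=
      coeff_formOfCoeffs (fun m => (b m : K)) ⟨m, hm⟩
    simp only [h]
    exact ⟨(b ⟨m, hm⟩).2, hb ⟨m, hm⟩⟩
  · have h : (formOfCoeffs d fun m => (b m : K)).coeff m = 0 :=
      (isHomogeneous_formOfCoeffs d _).coeff_eq_zero hm
    simp only [h, hF.coeff_eq_zero hm]
    exact ⟨zero_mem _, map_zero S.res⟩

theorem exists_isGenericDeformation (htr : Cardinal.aleph0 ≤ Algebra.trdeg L K) {d e : ℕ}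
    {F G : MvPolynomial (Fin 3) L} (hF : F.IsHomogeneous d) (hG : G.IsHomogeneous e) :
    ∃ F' G' : MvPolynomial (Fin 3) K, S.IsGenericDeformation d e F G F' G' := by
  obtain ⟨b, hb, hres⟩ := S.exists_algebraicIndependent_res_eq htr
    ({m : Fin 3 →₀ ℕ // m.degree = d} ⊕ {m : Fin 3 →₀ ℕ // m.degree = e})
    (Sum.elim (fun m => F.coeff m.1) fun m => G.coeff m.1)
  refine ⟨formOfCoeffs d fun m => (b (Sum.inl m) : K), formOfCoeffs e fun m => (b (Sum.inr m) : K),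
    isHomogeneous_formOfCoeffs d _, isHomogeneous_formOfCoeffs e _,
    S.formTo_formOfCoeffs hF _ fun m => hres _, S.formTo_formOfCoeffs hG _ fun m => hres _, ?_⟩
  convert hb using 1
  funext m
  rcases m with m | m <;> exact coeff_formOfCoeffs _ m

/-- A form that specialises has a model over the valuation ring. -/
theorem FormTo.exists_model {S : Specialisation L K} {d : ℕ} {F' : MvPolynomial (Fin 3) K}
    {F : MvPolynomial (Fin 3) L} (h : S.FormTo F' F) (hF' : F'.IsHomogeneous d)
    (hF : F.IsHomogeneous d) :
    ∃ R : MvPolynomial (Fin 3) S.ring, R.map S.ring.subtype = F' ∧ R.map S.res = F := by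
  choose hmem hres using h
  refine ⟨formOfCoeffs d fun m => ⟨F'.coeff m.1, hmem m.1⟩, ?_, ?_⟩
  · rw [map_formOfCoeffs]
    exact formOfCoeffs_coeff hF'
  · rw [map_formOfCoeffs]
    simp_rw [hres]
    exact formOfCoeffs_coeff hF

/-- Every point of the projective plane over `K` has homogeneous coordinates in the valuation ring
that do not all specialise to zero. -/
theorem exists_integral_coordinates (y : ℙ K (Fin 3 → K)) :
    ∃ (w : Fin 3 → S.ring) (hK : (fun j => (w j : K)) ≠ 0), (fun j => S.res (w j)) ≠ 0 ∧
      y = Projectivization.mk K _ hK := by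
  obtain ⟨i, hi⟩ := Finite.exists_max fun j => S.ring.valuation (y.rep j)
  have hi0 : y.rep i ≠ 0 := by
    intro h0
    refine y.rep_nonzero (funext fun j => ?_)
    have := hi j
    rw [h0, map_zero] at this
    exact (S.ring.valuation.zero_iff).1 (le_zero_iff.1 this)
  have hmem : ∀ j, y.rep j / y.rep i ∈ S.ring := fun j => by
    rw [← ValuationSubring.valuation_le_one_iff, map_div₀]
    exact div_le_one_of_le₀ (hi j) zero_le
  have hwi : (⟨y.rep i / y.rep i, hmem i⟩ : S.ring) = 1 := Subtype.ext (div_self hi0)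
  have hK : (fun j => ((⟨y.rep j / y.rep i, hmem j⟩ : S.ring) : K)) ≠ 0 := fun h => by
    have := congrFun h i
    simp [hi0] at this
  refine ⟨fun j => ⟨y.rep j / y.rep i, hmem j⟩, hK, fun h => ?_, ?_⟩
  · have := congrFun h i
    simp only [hwi] at this
    simp at this
  · conv_lhs => rw [← y.mk_rep]
    rw [Projectivization.mk_eq_mk_iff']
    refine ⟨y.rep i, funext fun j => ?_⟩
    simp [mul_div_cancel₀ _ hi0]

theorem exists_pointTo_of_mem_commonZeros {d e : ℕ} {F G : MvPolynomial (Fin 3) L}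
    {F' G' : MvPolynomial (Fin 3) K} (hF : F.IsHomogeneous d) (hG : G.IsHomogeneous e)
    (hF' : F'.IsHomogeneous d) (hG' : G'.IsHomogeneous e) (hFF : S.FormTo F' F)
    (hGG : S.FormTo G' G) {y : ℙ K (Fin 3 → K)} (hy : y ∈ commonZeros F' G') :
    ∃ x ∈ commonZeros F G, S.PointTo y x := by
  obtain ⟨w, hK, hL, rfl⟩ := S.exists_integral_coordinates y
  refine ⟨Projectivization.mk L _ hL, ?_, w, hK, hL, rfl, rfl⟩
  obtain ⟨R, rfl, rfl⟩ := hFF.exists_model hF' hF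
  obtain ⟨Q, rfl, rfl⟩ := hGG.exists_model hG' hG
  rw [mk_mem_commonZeros_iff hF' hG'] at hy
  rw [mk_mem_commonZeros_iff hF hG]
  have key : ∀ P : MvPolynomial (Fin 3) S.ring,
      eval (fun j => (w j : K)) (P.map S.ring.subtype) = 0 →
      eval (fun j => S.res (w j)) (P.map S.res) = 0 := by
    intro P hP
    have h1 : S.ring.subtype (eval w P) = 0 := (MvPolynomial.map_eval _ _ _).trans hP
    have h2 : eval w P = 0 := Subtype.ext h1
    have h3 := congrArg S.res h2
    rw [MvPolynomial.map_eval, map_zero] at h3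
    exact h3
  exact ⟨key R hy.1, key Q hy.2⟩

/-- A point specialising to `x` lies in each affine chart that contains `x`, and its affine
coordinates there specialise to those of `x`. -/
theorem PointTo.exists_affine_coordinates {S : Specialisation L K} {y : ℙ K (Fin 3 → K)}
    {x : ℙ L (Fin 3 → L)} (h : S.PointTo y x) {i : Fin 3} (hi : x.rep i ≠ 0) :
    ∃ P : Fin 2 → S.ring, (∀ j, S.res (P j) = x.rep (i.succAbove j) / x.rep i) ∧
      ∃ hne : (fun j => ((i.insertNth 1 P : Fin 3 → S.ring) j : K)) ≠ 0,
        y = Projectivization.mk K _ hne := by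
  obtain ⟨w, hK, hL, rfl, rfl⟩ := h
  obtain ⟨a, ha⟩ := Projectivization.exists_smul_eq_mk_rep L (fun j => S.res (w j)) hL
  have ha' : ∀ j, (Projectivization.mk L (fun j => S.res (w j)) hL).rep j = a * S.res (w j) :=
    fun j => by rw [← ha]; rfl
  have hwi : S.res (w i) ≠ 0 := by
    intro h0
    rw [ha', h0, mul_zero] at hi
    exact hi rfl
  obtain ⟨u, hu⟩ := S.isUnit_of_res_ne_zero hwi
  have hwu : w i * ((u⁻¹ : S.ringˣ) : S.ring) = 1 := by rw [← hu, Units.mul_inv]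
  have hins : (i.insertNth 1 fun j => w (i.succAbove j) * ((u⁻¹ : S.ringˣ) : S.ring)) =
      fun j => w j * ((u⁻¹ : S.ringˣ) : S.ring) := by
    funext j
    refine Fin.succAboveCases i ?_ (fun j => ?_) j
    · simp [hwu]
    · simp
  refine ⟨fun j => w (i.succAbove j) * ((u⁻¹ : S.ringˣ) : S.ring), fun j => ?_, ?_, ?_⟩
  · have hres := congrArg S.res hwu
    rw [map_mul, map_one] at hres
    rw [ha', ha', mul_div_mul_left _ _ a.ne_zero, map_mul, eq_div_iff hwi]
    linear_combination (S.res (w (i.succAbove j))) * hres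
  · intro h
    have := congrFun h i
    simp at this
  · rw [Projectivization.mk_eq_mk_iff']
    refine ⟨w i, funext fun j => ?_⟩
    rw [hins]
    have := congrArg (fun z : S.ring => (z : K)) hwu
    simp only [MulMemClass.coe_mul, OneMemClass.coe_one] at this
    simp only [Pi.smul_apply, smul_eq_mul, MulMemClass.coe_mul]
    linear_combination (w j : K) * this

/-- The number of points of the intersection of a deformation that specialise to `x` is at most
the dimension of the local ring of the intersection at `x`. -/
theorem encard_inter_le_finrank {d e : ℕ} {F G : MvPolynomial (Fin 3) L}
    {F' G' : MvPolynomial (Fin 3) K} (hF : F.IsHomogeneous d) (hG : G.IsHomogeneous e)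
    (hF' : F'.IsHomogeneous d) (hG' : G'.IsHomogeneous e) (hFF : S.FormTo F' F)
    (hGG : S.FormTo G' G) {x : ℙ L (Fin 3 → L)} {i : Fin 3} (hi : x.rep i ≠ 0) {p : Fin 2 → L}
    (hp : p = fun j => x.rep (i.succAbove j) / x.rep i) {r : ℕ}
    (hr : pointIdeal p ^ r ≤
      truncatedIdeal (dehomogenise i F) (dehomogenise i G) p (r + 1))
    [Module.Finite L (PlaneLocalRing p ⧸
      localIdeal p (dehomogenise i F) (dehomogenise i G))] :
    (commonZeros F' G' ∩ {y | S.PointTo y x}).encard ≤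
      Module.finrank L (PlaneLocalRing p ⧸ localIdeal p (dehomogenise i F) (dehomogenise i G)) := by
  have hfinset : ∀ T : Finset (ℙ K (Fin 3 → K)), ↑T ⊆ commonZeros F' G' ∩ {y | S.PointTo y x} →
      T.card ≤ Module.finrank L (PlaneLocalRing p ⧸
        localIdeal p (dehomogenise i F) (dehomogenise i G)) := by
    intro T hT
    obtain ⟨R, rfl, rfl⟩ := hFF.exists_model hF' hF
    obtain ⟨Q, rfl, rfl⟩ := hGG.exists_model hG' hG
    choose P hP hne hy using fun y : T => (hT y.2).2.exists_affine_coordinates hi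
    obtain ⟨q, hq⟩ := exists_forall_sub_sum_mem_truncatedIdeal hr
    have hzero : ∀ y, eval (P y) (dehomogeniseHom i R) = 0 ∧
        eval (P y) (dehomogeniseHom i Q) = 0 := by
      intro y
      have h := (hT y.2).1
      rw [hy y, mk_mem_commonZeros_iff hF' hG'] at h
      rw [eval_dehomogeniseHom, eval_dehomogeniseHom]
      exact ⟨Subtype.ext ((MvPolynomial.map_eval S.ring.subtype _ _).trans h.1),
        Subtype.ext ((MvPolynomial.map_eval S.ring.subtype _ _).trans h.2)⟩
    have hinj : Function.Injective P := by
      intro y y' h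
      apply Subtype.ext
      rw [hy y, hy y']
      congr 1
      rw [h]
    have := S.card_le_of_forall_mem_truncatedIdeal (f' := dehomogeniseHom i R)
      (g' := dehomogeniseHom i Q) (p := p) (fun y j => by rw [hP, hp]) hinj
      (fun y => (hzero y).1) (fun y => (hzero y).2) q fun h => by
        rw [map_dehomogeniseHom, map_dehomogeniseHom]
        exact hq _ h
    simpa using this
  by_contra! hlt
  obtain ⟨T, hTs, hT⟩ := Set.exists_subset_encard_eq (Order.add_one_le_of_lt hlt)
  have hTfin : T.Finite := Set.finite_of_encard_eq_coe (k := Module.finrank L (PlaneLocalRing p ⧸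
    localIdeal p (dehomogenise i F) (dehomogenise i G)) + 1) (by rw [hT]; norm_cast)
  have h1 := hfinset hTfin.toFinset (by simpa using hTs)
  rw [hTfin.encard_eq_coe_toFinset_card] at hT
  have h2 : hTfin.toFinset.card = Module.finrank L (PlaneLocalRing p ⧸
    localIdeal p (dehomogenise i F) (dehomogenise i G)) + 1 := by exact_mod_cast hT
  omega

end Specialisation

/-! ### The comparison of multiplicities -/

/-- Homogeneous coordinates normalised in a chart. -/
theorem insertNth_one_div_eq_smul {k : Type*} [Field k] {v : Fin 3 → k} {i : Fin 3} (hi : v i ≠ 0) :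
    (i.insertNth 1 (fun j => v (i.succAbove j) / v i) : Fin 3 → k) = (v i)⁻¹ • v := by
  funext j
  refine Fin.succAboveCases i ?_ (fun j => ?_) j
  · simp [hi]
  · simp [div_eq_inv_mul]

/-- Distinct points of the projective plane are separated by a line. -/
theorem exists_linear_form_separating {k : Type*} [Field k] {x y : ℙ k (Fin 3 → k)} (hxy : x ≠ y)
    {i i' : Fin 3} (hi : x.rep i ≠ 0) (hi' : y.rep i' ≠ 0) :
    ∃ l : MvPolynomial (Fin 3) k, l.IsHomogeneous 1 ∧
      eval (fun j => y.rep (i'.succAbove j) / y.rep i') (dehomogenise i' l) = 0 ∧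
      eval (fun j => x.rep (i.succAbove j) / x.rep i) (dehomogenise i l) ≠ 0 := by
  obtain ⟨m, hm⟩ : ∃ m, y.rep i' * x.rep m - y.rep m * x.rep i' ≠ 0 := by
    by_contra! h
    apply hxy
    rw [← x.mk_rep, ← y.mk_rep, Projectivization.mk_eq_mk_iff']
    refine ⟨x.rep i' / y.rep i', funext fun m => ?_⟩
    simp only [Pi.smul_apply, smul_eq_mul]
    rw [div_mul_eq_mul_div, div_eq_iff hi']
    linear_combination -h m
  have hl : (C (y.rep i') * X m - C (y.rep m) * X i' : MvPolynomial (Fin 3) k).IsHomogeneous 1 :=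
    (isHomogeneous_C_mul_X _ _).sub (isHomogeneous_C_mul_X _ _)
  refine ⟨_, hl, ?_, ?_⟩
  · rw [← dehomogeniseHom_apply, eval_dehomogeniseHom, insertNth_one_div_eq_smul hi',
      eval_smul_of_isHomogeneous hl]
    simp [mul_comm]
  · rw [← dehomogeniseHom_apply, eval_dehomogeniseHom, insertNth_one_div_eq_smul hi,
      eval_smul_of_isHomogeneous hl]
    simpa [hi] using hm

namespace Specialisation

/-- All the inequalities between the numbers of specialising points, the dimensions of the local
rings, and `d e` are equalities. -/
theorem IsGenericDeformation.exists_encard_eq {L K : Type*} [Field L] [IsAlgClosed L] [Field K]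
    [IsAlgClosed K] [Algebra L K] {S : Specialisation L K} {d e : ℕ}
    {F G : MvPolynomial (Fin 3) L} {F' G' : MvPolynomial (Fin 3) K}
    (hdef : S.IsGenericDeformation d e F G F' G') (hF : F.IsHomogeneous d) (hF0 : F ≠ 0)
    (hG : G.IsHomogeneous e) (hfin : (commonZeros F G).Finite)
    (i : ℙ L (Fin 3 → L) → Fin 3) (hi : ∀ x : ℙ L (Fin 3 → L), x.rep (i x) ≠ 0) :
    ∃ M : ℙ L (Fin 3 → L) → ℕ,
      (∀ x ∈ commonZeros F G, (commonZeros F' G' ∩ {y | S.PointTo y x}).encard = M x ∧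
        affineIntersectionMultiplicity (dehomogenise (i x) F) (dehomogenise (i x) G)
          (fun j => x.rep ((i x).succAbove j) / x.rep (i x)) = M x) ∧
      ∑ x ∈ hfin.toFinset, M x = d * e := by
  classical
  let p : ℙ L (Fin 3 → L) → Fin 2 → L := fun x j => x.rep ((i x).succAbove j) / x.rep (i x)
  have hrel := isRelPrime_of_finite_commonZeros hF hG hF0 hfin
  obtain ⟨⟨r, hr⟩, hfd, hsum⟩ := sum_finrank_localRing_le hF hG hF0 hrel
    (fun x : hfin.toFinset => i x.1) (fun x => p x.1) fun a b hab =>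
      exists_linear_form_separating (fun h => hab (Subtype.ext h)) (hi a.1) (hi b.1)
  let I : ℙ L (Fin 3 → L) → ℕ := fun x => Module.finrank L
    (PlaneLocalRing (p x) ⧸ localIdeal (p x) (dehomogenise (i x) F) (dehomogenise (i x) G))
  have hsumI : ∑ x ∈ hfin.toFinset, I x ≤ d * e := by
    rw [← Finset.sum_coe_sort]
    exact hsum
  have hle : ∀ x ∈ commonZeros F G, (commonZeros F' G' ∩ {y | S.PointTo y x}).encard ≤ I x := by
    intro x hx
    have hx' : x ∈ hfin.toFinset := hfin.mem_toFinset.2 hx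
    have := hfd ⟨x, hx'⟩
    exact S.encard_inter_le_finrank hF hG hdef.homogeneous_left hdef.homogeneous_right
      hdef.formTo_left hdef.formTo_right (hi x) rfl (hr ⟨x, hx'⟩)
  obtain ⟨T, hT, hTcard⟩ := exists_finset_card_eq_mul_of_algebraicIndependent
    hdef.homogeneous_left hdef.homogeneous_right hdef.generic
  choose! π hπ hπto using fun y (hy : y ∈ commonZeros F' G') =>
    S.exists_pointTo_of_mem_commonZeros hF hG hdef.homogeneous_left hdef.homogeneous_right
      hdef.formTo_left hdef.formTo_right hy
  have hfiber : ∀ x, ((T.filter fun y => π y = x).card : ℕ∞) ≤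
      (commonZeros F' G' ∩ {y | S.PointTo y x}).encard := by
    intro x
    rw [← Set.encard_coe_eq_coe_finsetCard]
    refine Set.encard_le_encard fun y hy => ?_
    obtain ⟨hyT, rfl⟩ := Finset.mem_filter.1 (Finset.mem_coe.1 hy)
    exact ⟨hT hyT, hπto y (hT hyT)⟩
  have hfiberI : ∀ x ∈ hfin.toFinset, (T.filter fun y => π y = x).card ≤ I x := fun x hx => by
    exact_mod_cast (hfiber x).trans (hle x (hfin.mem_toFinset.1 hx))
  have hTsum : T.card = ∑ x ∈ hfin.toFinset, (T.filter fun y => π y = x).card :=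
    Finset.card_eq_sum_card_fiberwise fun y hy => hfin.mem_toFinset.2 (hπ y (hT hy))
  have hsum_eq : ∑ x ∈ hfin.toFinset, (T.filter fun y => π y = x).card =
      ∑ x ∈ hfin.toFinset, I x :=
    le_antisymm (Finset.sum_le_sum hfiberI) (by rw [← hTsum, hTcard]; exact hsumI)
  have heq := (Finset.sum_eq_sum_iff_of_le hfiberI).1 hsum_eq
  refine ⟨I, fun x hx => ⟨le_antisymm (hle x hx) ?_, ?_⟩, by rw [← hsum_eq, ← hTsum, hTcard]⟩
  · rw [← heq x (hfin.mem_toFinset.2 hx)]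
    exact hfiber x
  · have := hfd ⟨x, hfin.mem_toFinset.2 hx⟩
    exact affineIntersectionMultiplicity_eq_finrank _ _

end Specialisation

theorem theorem4p20 {L K : Type*} [Field L] [IsAlgClosed L] [Field K] [IsAlgClosed K] [Algebra L K]
    (htr : Cardinal.aleph0 ≤ Algebra.trdeg L K) (S : Specialisation L K)
    (d e : ℕ) (F G : MvPolynomial (Fin 3) L)
    (hF : F.IsHomogeneous d) (hF0 : F ≠ 0) (hG : G.IsHomogeneous e) (hG0 : G ≠ 0)
    (hfin : (commonZeros F G).Finite) :
    ∃ M : ℙ L (Fin 3 → L) → ℕ,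
      (∀ x ∈ commonZeros F G,
        S.HasZariskiMultiplicity d e F G x (M x) ∧ HasIntersectionMultiplicity F G x (M x)) ∧
      ∑ x ∈ hfin.toFinset, M x = d * e := by
  classical
  choose i hi using fun x : ℙ L (Fin 3 → L) => Function.ne_iff.1 x.rep_nonzero
  obtain ⟨F₁, G₁, hdef⟩ := S.exists_isGenericDeformation htr hF hG
  obtain ⟨M, hM, hsum⟩ := hdef.exists_encard_eq hF hF0 hG hfin i hi
  refine ⟨M, fun x hx => ⟨⟨⟨F₁, G₁, hdef⟩, fun F' G' hdef' => ?_⟩, fun j hj => ?_⟩, hsum⟩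
  · -- two deformations are compared through the intersection multiplicity in a common chart
    obtain ⟨M', hM', -⟩ := hdef'.exists_encard_eq hF hF0 hG hfin i hi
    rw [(hM' x hx).1, ← (hM' x hx).2, (hM x hx).2]
  · -- two charts are compared through the number of points of a common deformation
    obtain ⟨M', hM', -⟩ := hdef.exists_encard_eq hF hF0 hG hfin (Function.update i x j) fun y => by
      rcases eq_or_ne y x with rfl | hy
      · rwa [Function.update_self]
      · rw [Function.update_of_ne hy]
        exact hi y
    have h := (hM' x hx).2
    rw [Function.update_self] at h
    rw [h, ← (hM' x hx).1, (hM x hx).1]
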